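/- **Model.** Fix $\lambda_s,\lambda_{ap},\lambda_{sk},\lambda_e^s,\lambda_e^{ap}>0$, $\rho_s,\rho_{ap}\in(0,1)$, path-loss exponents $\alpha,\beta>2$, transmit powers $P_s,P_{ap}>0$ of sensors and access points (APs), $\mu=P_{ap}/P_s$, noise power $\delta^2\ge 0$, and a number $M\ge 1$ of antennas per AP; sensors, sinks and eavesdroppers have one antenna. In the plane, the active sensors $\Phi_{s,a}$, the receiving (non-forwarding) APs, the active (forwarding) APs $\Phi_{ap,a}$, the sinks $\Phi_{sk}$, the first-hop eavesdroppers $\Phi_{s,e}$ and the second-hop eavesdroppers $\Phi_{ap,e}$ form homogeneous Poisson point processes with intensities $\lambda_s\rho_s$, $\lambda_{ap}(1-\rho_{ap})$, $\lambda_{ap}\rho_{ap}$, $\lambda_{sk}$, $\lambda_e^s$, $\lambda_e^{ap}$. All fading coefficients are i.i.d. $\mathcal{CN}(0,1)$. Everything is mutually independent; in particular every receiver (the typical AP, the typical sink, and each eavesdropper) sees its own independent copy of the interfering processes $\Phi_{s,a}$, $\Phi_{ap,a}$ and of the fading, and the two hops are independent. *First hop.* The typical sensor, at the origin, sends to its nearest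 receiving AP, at $x_0$, over the channel $\mathbf h\in\mathbb C^{M}$. With maximal-ratio combining $u=\mathbf h^\dagger/\|\mathbf h\|$, $$\gamma_{ap}=\frac{\|\mathbf h\|^2|x_0|^{-\alpha}}{\sum_{i\in\Phi_{s,a}}|u\,\mathbf h_i|^2|x_i-x_0|^{-\alpha}+\mu\sum_{j\in\Phi_{ap,a}}|u\,\mathbf H_jw_j|^2|x_j-x_0|^{-\alpha}+\delta^2/P_s},$$ $$\gamma_{s,e}=\sup_{e\in\Phi_{s,e}}\frac{|h_e|^2|e|^{-\alpha}}{\sum_{i\in\Phi_{s,a}}|h_{i,e}|^2|x_i-e|^{-\alpha}+\mu\sum_{j\in\Phi_{ap,a}}|\mathbf h_{j,e}w_j|^2|x_j-e|^{-\alpha}+\delta^2/P_s},$$ where $w_j=\mathbf h_{j,sk_j}^\dagger/\|\mathbf h_{j,sk_j}\|$ is the maximal-ratio transmission beamformer of AP $j$ toward its own sink. *Second hop.* In coordinates with the typical AP at the origin, it sends to its nearest sink, at $z_0$, over the channel $\mathbf g\in\mathbb C^{1\times M}$ with the beamformer $\mathbf g^\dagger/\|\mathbf g\|$: $$\gamma_{sk}=\frac{\|\mathbf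 g\|^2|z_0|^{-\beta}}{\sum_{j\in\Phi_{ap,a}}|\mathbf g_jw_j|^2|x_j-z_0|^{-\beta}+\delta^2/P_{ap}},\qquad \gamma_{ap,e}=\sup_{e\in\Phi_{ap,e}}\frac{|\mathbf g_e\mathbf g^\dagger/\|\mathbf g\||^2|e|^{-\beta}}{\sum_{j\in\Phi_{ap,a}}|\mathbf g_{j,e}w_j|^2|x_j-e|^{-\beta}+\delta^2/P_{ap}}.$$ The instantaneous secrecy rates are $C_s^{ap}=[\log_2(1+\gamma_{ap})-\log_2(1+\gamma_{s,e})]^+$, $C_s^{sk}=[\log_2(1+\gamma_{sk})-\log_2(1+\gamma_{ap,e})]^+$ and $C_s=\min(C_s^{ap},C_s^{sk})$, and the overall average secrecy rate is $\bar C_s=\mathbb E[C_s]$. **Claim.** For all $M\ge1$ and $\delta^2\ge0$ (as an identity in $[0,\infty]$), $$\bar C_s=\int_0^\infty \Pr(C_s^{ap}>x)\,\Pr(C_s^{sk}>x)\,dx .$$ In the interference-limited case with a single antenna at the APs ($\delta^2=0$, $M=1$), $C_s$ is integrable and $$\bar C_s=\int_0^\infty\left[\int_0^\infty\frac{2\p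i\lambda_e^s}{\alpha\Lambda_1y^{2/\alpha+1}}\exp\Big\{-\frac{\pi\lambda_e^s}{\Lambda_1y^{2/\alpha}}\Big\}\frac{\pi\lambda_{ap}(1-\rho_{ap})}{\Lambda_1(2^x(1+y)-1)^{2/\alpha}+\pi\lambda_{ap}(1-\rho_{ap})}\,dy\right]\left[\int_0^\infty\frac{2\pi^2\lambda_e^{ap}\lambda_{sk}\exp\big\{-\frac{\pi\lambda_e^{ap}}{\Lambda_2y^{2/\beta}}\big\}}{\beta\Lambda_2y^{2/\beta+1}\big(\Lambda_2(2^x(1+y)-1)^{2/\beta}+\pi\lambda_{sk}\big)}\,dy\right]dx,$$ where $\Lambda_1=(\lambda_s\rho_s+\lambda_{ap}\rho_{ap}\mu^{2/\alpha})\,\pi\,\Gamma(1+2/\alpha)\Gamma(1-2/\alpha)$ and $\Lambda_2=\lambda_{ap}\rho_{ap}\,\pi\,\Gamma(1+2/\beta)\Gamma(1-2/\beta)$. -/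

import Mathlib

open MeasureTheory ProbabilityTheory Set
open scoped ENNReal NNReal

set_option synthInstance.maxSize 1024

noncomputable section

namespace WSN

/-- The plane with its Euclidean distance. -/
abbrev Plane := EuclideanSpace ℝ (Fin 2)

/-! ### Homogeneous Poisson point processes -/

/-- The number of points of the configuration `x` (an enumeration of a countable set of points)
that lie in `B`. -/
def numPoints (B : Set Plane) (x : ℕ → Plane) : ℕ∞ := {n | x n ∈ B}.encard

/-- `Q` is the law of (an enumeration of the points of) a homogeneous Poisson point process of
intensity `lam` in the plane: the number of points in a Borel set `B` of finite area is
Poisson distributed with mean `lam * area B`, and the numbers of points in finitely many disjoint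
such sets are independent. -/
structure IsHPPP (lam : ℝ) (Q : Measure (ℕ → Plane)) : Prop where
  poisson : ∀ B : Set Plane, MeasurableSet B → volume B ≠ ∞ →
    HasLaw (numPoints B) ((poissonMeasure (lam * volume.real B).toNNReal).map (fun k : ℕ => (k : ℕ∞))) Q
  indep : ∀ (m : ℕ) (B : Fin m → Set Plane), (∀ i, MeasurableSet (B i)) →
    (∀ i, volume (B i) ≠ ∞) → Pairwise (fun i j => Disjoint (B i) (B j)) →
    iIndepFun (fun i => numPoints (B i)) Q

/-- The point of a configuration that is nearest to the origin (`0` if there is none). -/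
def nearest (x : ℕ → Plane) : Plane :=
  open Classical in
  if h : ∃ n, ∀ m, ‖x n‖ ≤ ‖x m‖ then x (Nat.find h) else 0

/-- A configuration of marked points: locations together with one mark for each point. -/
abbrev Marked (K : Type) := (ℕ → Plane) × (ℕ → K)

/-- The law of an independently marked point process: locations with law `Q`, and i.i.d. marks
with law `ν`, independent of the locations. -/
def markedLaw {K : Type} [MeasurableSpace K] (Q : Measure (ℕ → Plane)) (ν : Measure K) :
    Measure (Marked K) :=
  Q.prod (Measure.infinitePi fun _ : ℕ => ν)

/-! ### Channels -/

/-- The circularly symmetric complex Gaussian law with mean zero and unit variance: independent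
real and imaginary parts, each of variance `1 / 2` (Rayleigh fading). -/
def rayleigh : Measure ℂ :=
  ((gaussianReal 0 (1 / 2)).prod (gaussianReal 0 (1 / 2))).map Complex.measurableEquivRealProd.symm

instance : IsProbabilityMeasure rayleigh :=
  Measure.isProbabilityMeasure_map Complex.measurableEquivRealProd.symm.measurable.aemeasurable

/-- A vector of `M` i.i.d. Rayleigh fading coefficients. -/
def rayleighVec (M : ℕ) : Measure (Fin M → ℂ) := Measure.pi fun _ => rayleigh

instance (M : ℕ) : IsProbabilityMeasure (rayleighVec M) := by
  unfold rayleighVec; infer_instance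

/-- An `M × M` array of i.i.d. Rayleigh fading coefficients. -/
def rayleighMat (M : ℕ) : Measure (Fin M → Fin M → ℂ) := Measure.pi fun _ => rayleighVec M

instance (M : ℕ) : IsProbabilityMeasure (rayleighMat M) := by
  unfold rayleighMat; infer_instance

/-- The squared Euclidean norm of a channel vector. -/
def energy {M : ℕ} (h : Fin M → ℂ) : ℝ := ∑ a, ‖h a‖ ^ 2

/-- The combining / beamforming vector `h† / ‖h‖`. -/
def beam {M : ℕ} (h : Fin M → ℂ) : Fin M → ℂ :=
  fun a => star (h a) / ((√(energy h) : ℝ) : ℂ)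

/-- The power gain `|z|²`. -/
def gain (z : ℂ) : ℝ≥0∞ := ENNReal.ofReal (‖z‖ ^ 2)

/-- The path loss `|x - y|^(-α)`. -/
def pathLoss (α : ℝ) (x y : Plane) : ℝ≥0∞ := ENNReal.ofReal (dist x y) ^ (-α)

/-! ### Interference -/

/-- Interference of the active sensors at a single-antenna receiver located at `y`. -/
def sensorInterf (α : ℝ) (y : Plane) (F : Marked ℂ) : ℝ≥0∞ :=
  ∑' i, gain (F.2 i) * pathLoss α (F.1 i) y

/-- Interference of the active sensors, received with `M` antennas at `y` and combined with the
vector `u`; the mark of a sensor is its channel vector to the receiver. -/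
def sensorInterfMRC {M : ℕ} (α : ℝ) (u : Fin M → ℂ) (y : Plane) (F : Marked (Fin M → ℂ)) : ℝ≥0∞ :=
  ∑' i, gain (∑ a, u a * F.2 i a) * pathLoss α (F.1 i) y

/-- Interference (before scaling by the transmit power) of the active access points at a
single-antenna receiver located at `y`; the mark of an access point consists of its channel vector
to the receiver and its channel vector to its own sink, from which its beamformer is formed. -/
def apInterf {M : ℕ} (α : ℝ) (y : Plane) (F : Marked ((Fin M → ℂ) × (Fin M → ℂ))) : ℝ≥0∞ :=
  ∑' j, gain (∑ b, (F.2 j).1 b * beam (F.2 j).2 b) * pathLoss α (F.1 j) y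

/-- Interference (before scaling by the transmit power) of the active access points, received with
`M` antennas at `y` and combined with the vector `u`; the mark of an access point consists of its
channel matrix to the receiver and its channel vector to its own sink. -/
def apInterfMRC {M : ℕ} (α : ℝ) (u : Fin M → ℂ) (y : Plane)
    (F : Marked ((Fin M → Fin M → ℂ) × (Fin M → ℂ))) : ℝ≥0∞ :=
  ∑' j, gain (∑ a, u a * ∑ b, (F.2 j).1 a b * beam (F.2 j).2 b) * pathLoss α (F.1 j) y

/-! ### First hop: typical sensor (at the origin) to its nearest access point -/

/-- Mark of an eavesdropper on the first hop: its channel from the typical sensor, and the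
interfering sensors and access points that it sees. -/
abbrev EveMark₁ (M : ℕ) := ℂ × Marked ℂ × Marked ((Fin M → ℂ) × (Fin M → ℂ))

/-- The random input of the first hop: locations of the access points that can receive, channel
vector from the typical sensor to the typical access point, interfering sensors and
interfering access points seen by the typical access point, marked eavesdroppers. -/
abbrev Hop₁ (M : ℕ) :=
  (ℕ → Plane) × (Fin M → ℂ) × Marked (Fin M → ℂ) ×
    Marked ((Fin M → Fin M → ℂ) × (Fin M → ℂ)) × Marked (EveMark₁ M)

/-- The law of the input of the first hop, where `Qr`, `Qs`, `Qa`, `Qe` are the laws of the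
receiving access points, active sensors, active access points and eavesdroppers. All links are
independent, and every receiver sees its own independent copy of the interferers. -/
def hopLaw₁ (M : ℕ) (Qr Qs Qa Qe : Measure (ℕ → Plane)) : Measure (Hop₁ M) :=
  Qr.prod ((rayleighVec M).prod ((markedLaw Qs (rayleighVec M)).prod
    ((markedLaw Qa ((rayleighMat M).prod (rayleighVec M))).prod
      (markedLaw Qe (rayleigh.prod ((markedLaw Qs rayleigh).prod
        (markedLaw Qa ((rayleighVec M).prod (rayleighVec M)))))))))

/-- SINR at the typical access point; `μ` is the ratio of the transmit powers of access points and
sensors, `N` the noise power divided by the transmit power of a sensor. -/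
def sinrAP {M : ℕ} (α μ N : ℝ) : Hop₁ M → ℝ≥0∞
  | (r, h, S, A, _) =>
    ENNReal.ofReal (energy h) * pathLoss α 0 (nearest r) /
      (sensorInterfMRC α (beam h) (nearest r) S +
        ENNReal.ofReal μ * apInterfMRC α (beam h) (nearest r) A + ENNReal.ofReal N)

/-- SINR at the most detrimental eavesdropper on the first hop. -/
def sinrSE {M : ℕ} (α μ N : ℝ) : Hop₁ M → ℝ≥0∞
  | (_, _, _, _, E) =>
    ⨆ k, gain (E.2 k).1 * pathLoss α 0 (E.1 k) /
      (sensorInterf α (E.1 k) (E.2 k).2.1 +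
        ENNReal.ofReal μ * apInterf α (E.1 k) (E.2 k).2.2 + ENNReal.ofReal N)

/-! ### Second hop: typical access point (at the origin) to its nearest sink -/

/-- Mark of an eavesdropper on the second hop: its channel vector from the typical access point,
and the interfering access points that it sees. -/
abbrev EveMark₂ (M : ℕ) := (Fin M → ℂ) × Marked ((Fin M → ℂ) × (Fin M → ℂ))

/-- The random input of the second hop: locations of the sinks, channel vector from the typical
access point to the typical sink, interfering access points seen by the typical sink, marked
eavesdroppers. -/
abbrev Hop₂ (M : ℕ) :=
  (ℕ → Plane) × (Fin M → ℂ) × Marked ((Fin M → ℂ) × (Fin M → ℂ)) × Marked (EveMark₂ M)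

/-- The law of the input of the second hop, where `Qk`, `Qa`, `Qe` are the laws of the sinks,
active access points and eavesdroppers. All links are independent, and every receiver sees its own
independent copy of the interferers. -/
def hopLaw₂ (M : ℕ) (Qk Qa Qe : Measure (ℕ → Plane)) : Measure (Hop₂ M) :=
  Qk.prod ((rayleighVec M).prod ((markedLaw Qa ((rayleighVec M).prod (rayleighVec M))).prod
    (markedLaw Qe ((rayleighVec M).prod (markedLaw Qa ((rayleighVec M).prod (rayleighVec M)))))))

/-- SINR at the typical sink; `N` is the noise power divided by the transmit power of an access
point. -/
def sinrSK {M : ℕ} (β N : ℝ) : Hop₂ M → ℝ≥0∞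
  | (s, g, A, _) =>
    ENNReal.ofReal (energy g) * pathLoss β 0 (nearest s) /
      (apInterf β (nearest s) A + ENNReal.ofReal N)

/-- SINR at the most detrimental eavesdropper on the second hop, which overhears the signal that
the typical access point sends with the beamformer for its sink. -/
def sinrAPE {M : ℕ} (β N : ℝ) : Hop₂ M → ℝ≥0∞
  | (_, g, _, E) =>
    ⨆ k, gain (∑ b, (E.2 k).1 b * beam g b) * pathLoss β 0 (E.1 k) /
      (apInterf β (E.1 k) (E.2 k).2 + ENNReal.ofReal N)

/-! ### Secrecy rates -/

/-- The capacity `log₂ (1 + γ)` (all SINRs of the model are almost surely finite). -/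
def capacity (γ : ℝ≥0∞) : ℝ := Real.logb 2 (1 + γ.toReal)

/-- Instantaneous secrecy rate of the first hop. -/
def secrecyAP {M : ℕ} (α μ N : ℝ) (d : Hop₁ M) : ℝ :=
  max (capacity (sinrAP α μ N d) - capacity (sinrSE α μ N d)) 0

/-- Instantaneous secrecy rate of the second hop. -/
def secrecySK {M : ℕ} (β N : ℝ) (d : Hop₂ M) : ℝ :=
  max (capacity (sinrSK β N d) - capacity (sinrAPE β N d)) 0

/-- Instantaneous overall secrecy rate: access points with `M` antennas, transmit powers `Ps`, `Pap`
of sensors and access points, noise power `δsq`. -/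
def secrecy {M : ℕ} (α β Ps Pap δsq : ℝ) (d₁ : Hop₁ M) (d₂ : Hop₂ M) : ℝ :=
  min (secrecyAP α (Pap / Ps) (δsq / Ps) d₁) (secrecySK β (δsq / Pap) d₂)

/-- The constant `Λ₁`. -/
def Lam₁ (lams ρs lamap ρap μ α : ℝ) : ℝ :=
  (lams * ρs + lamap * ρap * μ ^ (2 / α)) * Real.pi * Real.Gamma (1 + 2 / α) *
    Real.Gamma (1 - 2 / α)

/-- The constant `Λ₂`. -/
def Lam₂ (lamap ρap β : ℝ) : ℝ :=
  lamap * ρap * Real.pi * Real.Gamma (1 + 2 / β) * Real.Gamma (1 - 2 / β)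

end WSN

end

/-! The general identity is the layer-cake formula. The secrecy rates of the hops are nonnegative
functions of independent inputs, and the minimum exceeds `x` exactly when both rates do
(`lintegral_ofReal_min`).

The closed form needs the tail of each hop's rate when `M = 1` and there is no noise. A
single-antenna beamformer is almost surely a unit phase, so every effective power gain is a unit
exponential variable. For a link of length `r`, conditioning on the interference `I` gives `P(SIR >
t) = E exp(-t r^α I)`. The Laplace functional of a marked Poisson process (`IsHPPP.laplace_marked`)
and the integral `lintegral_pathLoss` give `E exp(-s I) = exp(-Λ s^(2/α))`, so the link tail is
`exp(-Λ t^(2/α) r²)` (`HasInterfLaw.measure_lt_sir`). This Gaussian dependence on `r` is what makes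
two spatial averages explicit: - over the nearest receiver, where `π lam r²` is unit exponential,
the tail becomes `π lam / (Λ t^(2/α) + π lam)` (`IsHPPP.measure_lt_sir_nearest`); - over the
eavesdroppers, the probability that none exceeds `y` is a void probability with a Gaussian integral
in the exponent, `exp(-π lam / (Λ y^(2/α)))` (`IsHPPP.measure_iSup_le`).

The main ratio and the worst eavesdropper's ratio are independent. The rate exceeds `x` iff the main
ratio exceeds `2^x (1 + y) - 1`, where `y` is the eavesdropper's ratio, so the tail of the rate is
the link tail at this threshold integrated against the density of `y` (`measure_lt_secrecyRate`).
Integrability follows from the exponential decay of the first hop's tail alone.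

Laplace transforms take values in `[0, ∞]` through `expNeg`. No integrability conditions arise, and
the exponent `∞` turns a Laplace functional into a void probability. -/

namespace WSN

open Filter Topology

section

/-! ### The decreasing exponential on `[0, ∞]` -/

/-- The map `a ↦ exp (-a)` on `[0, ∞]`, with `exp (-∞) = 0`. -/
noncomputable def expNeg (a : ℝ≥0∞) : ℝ≥0∞ := EReal.exp (-(a : EReal))

@[simp] lemma expNeg_zero : expNeg 0 = 1 := by simp [expNeg]

@[simp] lemma expNeg_top : expNeg ∞ = 0 := by simp [expNeg]

lemma expNeg_ofReal {x : ℝ} (hx : 0 ≤ x) :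
    expNeg (ENNReal.ofReal x) = ENNReal.ofReal (Real.exp (-x)) := by
  rw [expNeg, EReal.coe_ennreal_ofReal, max_eq_left hx, ← EReal.coe_neg, EReal.exp_coe]

lemma expNeg_add (a b : ℝ≥0∞) : expNeg (a + b) = expNeg a * expNeg b := by
  rw [expNeg, expNeg, expNeg, ← EReal.exp_add, EReal.coe_ennreal_add, EReal.neg_add,
    sub_eq_add_neg] <;> simp

lemma expNeg_strictAnti : StrictAnti expNeg := fun a b h => by
  rw [expNeg, expNeg, EReal.exp_lt_exp_iff, EReal.neg_lt_neg_iff]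
  exact_mod_cast h

lemma expNeg_le_one (a : ℝ≥0∞) : expNeg a ≤ 1 := by
  simpa using expNeg_strictAnti.antitone (zero_le (a := a))

lemma expNeg_ne_top (a : ℝ≥0∞) : expNeg a ≠ ∞ := ne_top_of_le_ne_top (by simp) (expNeg_le_one a)

lemma continuous_expNeg : Continuous expNeg := by
  unfold expNeg
  exact ENNReal.continuous_exp.comp (continuous_neg.comp continuous_coe_ennreal_ereal)

@[fun_prop] lemma measurable_expNeg : Measurable expNeg := continuous_expNeg.measurable

lemma expNeg_nsmul (c : ℝ≥0∞) (k : ℕ) : expNeg (c * k) = expNeg c ^ k := by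
  induction k with
  | zero => simp
  | succ k ih => rw [Nat.cast_succ, mul_add, mul_one, expNeg_add, ih, pow_succ]

lemma expNeg_sum {ι : Type*} (s : Finset ι) (f : ι → ℝ≥0∞) :
    expNeg (∑ i ∈ s, f i) = ∏ i ∈ s, expNeg (f i) := by
  classical
  induction s using Finset.induction_on with
  | empty => simp
  | insert a s ha ih => rw [Finset.sum_insert ha, Finset.prod_insert ha, expNeg_add, ih]

/-- Any factor in `[0, 1]` is an exponential weight. An average over marks can therefore be absorbed
into a deterministic exponent at each location. -/
lemma exists_expNeg_eq {v : ℝ≥0∞} (hv : v ≤ 1) : expNeg (-(ENNReal.log v)).toENNReal = v := by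
  rw [expNeg, EReal.coe_toENNReal, neg_neg, ENNReal.exp_log]
  simpa [EReal.neg_nonneg] using hv

lemma tendsto_prod_expNeg (f : ℕ → ℝ≥0∞) :
    Tendsto (fun n => ∏ i ∈ Finset.range n, expNeg (f i)) atTop (𝓝 (expNeg (∑' i, f i))) := by
  simp_rw [← expNeg_sum]
  exact (continuous_expNeg.tendsto _).comp (ENNReal.tendsto_nat_tsum f)

/-! ### Laplace functional of a Poisson point process -/

/-- This is the Poisson generating function at `exp(-c)`. The value `c = ∞` is allowed: with `∞ * 0
= 0` it gives the probability of no points. -/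
lemma lintegral_expNeg_poisson (r : ℝ≥0) (c : ℝ≥0∞) :
    ∫⁻ k : ℕ, expNeg (c * k) ∂(poissonMeasure r) = expNeg (r * (1 - expNeg c)) := by
  obtain ⟨p, hp⟩ : ∃ p : ℝ≥0, expNeg c = p := ⟨_, (ENNReal.coe_toNNReal (expNeg_ne_top c)).symm⟩
  have hp1 : p ≤ 1 := by
    have := expNeg_le_one c
    rw [hp] at this
    exact_mod_cast this
  have e1 : (r : ℝ≥0∞) * (1 - expNeg c) = ENNReal.ofReal (r * (1 - p)) := by
    rw [hp, ENNReal.ofReal_mul r.coe_nonneg, ENNReal.ofReal_coe_nnreal, ENNReal.ofReal_sub _ p.coe_nonneg]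
    simp
  have hp1' : (p : ℝ) ≤ 1 := hp1
  rw [e1, expNeg_ofReal (mul_nonneg r.coe_nonneg (by linarith)), lintegral_countable']
  simp_rw [expNeg_nsmul, hp, poissonMeasure_singleton]
  have hs : HasSum (fun k : ℕ => Real.exp (-r) * ((r * p : ℝ) ^ k / k.factorial))
      (Real.exp (-r) * Real.exp (r * p)) := by
    refine HasSum.mul_left _ ?_
    rw [Real.exp_eq_exp_ℝ]
    exact NormedSpace.expSeries_div_hasSum_exp (r * p : ℝ)
  have : Real.exp (-(r * (1 - p))) = Real.exp (-r) * Real.exp (r * p) := by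
    rw [← Real.exp_add]; ring_nf
  rw [this, ← hs.tsum_eq, ENNReal.ofReal_tsum_of_nonneg (fun k => by positivity) hs.summable]
  refine tsum_congr fun k => ?_
  rw [← ENNReal.coe_pow, ← ENNReal.ofReal_coe_nnreal, ← ENNReal.ofReal_mul (by positivity)]
  congr 1
  push_cast
  ring

/-- The counting measure of a configuration of points. -/
noncomputable def countMeasure (x : ℕ → Plane) : Measure Plane :=
  Measure.sum fun i => Measure.dirac (x i)

lemma lintegral_countMeasure (x : ℕ → Plane) {f : Plane → ℝ≥0∞} (hf : Measurable f) :
    ∫⁻ z, f z ∂(countMeasure x) = ∑' i, f (x i) := by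
  rw [countMeasure, lintegral_sum_measure]
  simp_rw [lintegral_dirac' _ hf]

lemma countMeasure_apply (x : ℕ → Plane) {B : Set Plane} (hB : MeasurableSet B) :
    countMeasure x B = (numPoints B x : ℝ≥0∞) := by
  rw [← lintegral_indicator_one hB,
    lintegral_countMeasure x (measurable_one.indicator hB), numPoints, ← ENNReal.tsum_set_one,
    tsum_subtype {n | x n ∈ B} (fun _ => (1 : ℝ≥0∞))]
  rfl

lemma measurable_countMeasure {B : Set Plane} (hB : MeasurableSet B) :
    Measurable fun x => countMeasure x B := by
  simp_rw [← lintegral_indicator_one hB,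
    lintegral_countMeasure _ (measurable_one.indicator hB)]
  exact Measurable.tsum fun i =>
    (measurable_one.indicator hB).comp (measurable_pi_apply i)

variable {lam : ℝ} {Q : Measure (ℕ → Plane)}

lemma IsHPPP.iIndepFun (hQ : IsHPPP lam Q) {ι : Type*} [Fintype ι] (B : ι → Set Plane)
    (hB : ∀ i, MeasurableSet (B i)) (hf : ∀ i, volume (B i) ≠ ∞)
    (hd : Pairwise fun i j => Disjoint (B i) (B j)) :
    iIndepFun (fun i => numPoints (B i)) Q := by
  have e := (Fintype.equivFin ι).symm
  have := hQ.indep _ (B ∘ e) (fun i => hB _) (fun i => hf _) (fun i j hij => hd (e.injective.ne hij))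
  exact iIndepFun.of_precomp (g := e) e.surjective this

lemma IsHPPP.lintegral_expNeg_count (hQ : IsHPPP lam Q) (c : ℝ≥0∞)
    {B : Set Plane} (hB : MeasurableSet B) (hf : volume B ≠ ∞) :
    ∫⁻ x, expNeg (c * countMeasure x B) ∂Q =
      expNeg (ENNReal.ofReal lam * (volume B * (1 - expNeg c))) := by
  simp_rw [countMeasure_apply _ hB]
  have h := hQ.poisson B hB hf
  rw [← lintegral_map' (f := fun k : ℕ∞ => expNeg (c * k)) (measurable_of_countable _).aemeasurable
    h.aemeasurable, h.map_eq, lintegral_map (measurable_of_countable _) (by fun_prop)]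
  simp only [ENat.toENNReal_coe]
  rw [lintegral_expNeg_poisson, ← mul_assoc, ← ENNReal.ofReal, mul_comm lam, 
    ENNReal.ofReal_mul (by positivity), ofReal_measureReal hf, mul_comm (volume B)]

/-- The nonzero level sets of `f` are disjoint, so their counts are independent Poisson variables
and the functional factors. The zero level set may have infinite area, but it contributes nothing to
either side and is dropped. -/
lemma IsHPPP.laplace_simple (hQ : IsHPPP lam Q) (f : SimpleFunc Plane ℝ≥0∞)
    (hf : ∀ c ≠ 0, volume (f ⁻¹' {c}) ≠ ∞) :
    ∫⁻ x, expNeg (∫⁻ z, f z ∂(countMeasure x)) ∂Q =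
      expNeg (ENNReal.ofReal lam * ∫⁻ z, (1 - expNeg (f z))) := by
  classical
  set R := f.range.filter (· ≠ 0) with hR
  have key : ∀ (μ : Measure Plane) (g : ℝ≥0∞ → ℝ≥0∞), g 0 = 0 →
      ∫⁻ z, g (f z) ∂μ = ∑ c : R, g c * μ (f ⁻¹' {(c : ℝ≥0∞)}) := by
    intro μ g hg
    have h1 : ∫⁻ z, g (f z) ∂μ = (f.map g).lintegral μ := by
      rw [← SimpleFunc.lintegral_eq_lintegral]; rfl
    rw [h1, SimpleFunc.map_lintegral, Finset.sum_coe_sort R (fun c => g c * μ (f ⁻¹' {c})), hR,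
      Finset.sum_filter_of_ne]
    rintro c - h rfl
    simp [hg] at h
  have hR0 : ∀ c : R, (c : ℝ≥0∞) ≠ 0 := fun c => (Finset.mem_filter.1 c.2).2
  rw [key volume (fun c => 1 - expNeg c) (by simp)]
  have key' := fun μ => key μ id rfl
  simp only [id] at key'
  simp_rw [key', expNeg_sum]
  have hi := hQ.iIndepFun (fun c : R => f ⁻¹' {(c : ℝ≥0∞)}) (fun c => f.measurableSet_preimage _)
    (fun c => hf c (hR0 c)) (fun c d hcd => Disjoint.preimage _ (by
      simpa using fun h => hcd (Subtype.ext h)))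
  have hi' := hi.comp (fun c k => expNeg (c * (k : ℝ≥0∞))) (fun c => measurable_of_countable _)
  have e : (fun c : R => (fun k : ℕ∞ => expNeg (c * (k : ℝ≥0∞))) ∘ numPoints (f ⁻¹' {(c : ℝ≥0∞)}))
      = fun c : R => fun x => expNeg (c * countMeasure x (f ⁻¹' {(c : ℝ≥0∞)})) := by
    ext c x
    simp [countMeasure_apply _ (f.measurableSet_preimage _)]
  simp_rw [e] at hi'
  rw [lintegral_prod_eq_prod_lintegral_of_indepFun _ _ hi' (fun c => measurable_expNeg.comp
    ((measurable_countMeasure (f.measurableSet_preimage _)).const_mul _)), Finset.mul_sum,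
    expNeg_sum]
  refine Finset.prod_congr rfl fun c _ => ?_
  rw [hQ.lintegral_expNeg_count _ (f.measurableSet_preimage _) (hf c (hR0 c)), mul_comm (volume _)]

/-- The Laplace functional of a homogeneous Poisson point process. -/
theorem IsHPPP.laplace [IsProbabilityMeasure Q] (hQ : IsHPPP lam Q) {f : Plane → ℝ≥0∞}
    (hf : Measurable f) :
    ∫⁻ x, expNeg (∑' i, f (x i)) ∂Q = expNeg (ENNReal.ofReal lam * ∫⁻ z, (1 - expNeg (f z))) := by
  simp_rw [← lintegral_countMeasure _ hf]
  -- Restricting to balls makes every nonzero level set of finite area, as the simple-function case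
  -- requires. The approximation still increases to `f`.
  let s : ℕ → SimpleFunc Plane ℝ≥0∞ := fun n => (SimpleFunc.eapprox f n).restrict (Metric.ball 0 n)
  have hs : ∀ n z, s n z = (Metric.ball 0 (n : ℝ)).indicator (SimpleFunc.eapprox f n) z :=
    fun n z => by rw [SimpleFunc.restrict_apply _ Metric.isOpen_ball.measurableSet]
  have hmono : ∀ z, Monotone fun n => s n z := fun z m n hmn => by
    simp only [hs]
    refine (indicator_le_indicator (SimpleFunc.monotone_eapprox f hmn z)).trans ?_
    exact indicator_le_indicator_of_subset (Metric.ball_subset_ball (by exact_mod_cast hmn))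
      (fun _ => zero_le) z
  have hlim : ∀ z, Tendsto (fun n => s n z) atTop (𝓝 (f z)) := fun z => by
    have h1 : Tendsto (fun n => SimpleFunc.eapprox f n z) atTop (𝓝 (f z)) := by
      rw [← SimpleFunc.iSup_eapprox_apply hf z]
      exact tendsto_atTop_iSup fun m n hmn => SimpleFunc.monotone_eapprox f hmn z
    refine h1.congr' ?_
    obtain ⟨N, hN⟩ := exists_nat_gt ‖z‖
    filter_upwards [eventually_ge_atTop N] with n hn
    rw [hs, indicator_of_mem]
    simpa using hN.trans_le (by exact_mod_cast hn)
  have hfin : ∀ n, ∀ c ≠ 0, volume (s n ⁻¹' {c}) ≠ ∞ := fun n c hc => by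
    refine ne_top_of_le_ne_top (measure_ball_lt_top (x := (0 : Plane)) (r := n)).ne
      (measure_mono fun z hz => ?_)
    by_contra h
    rw [mem_preimage, mem_singleton_iff, hs, indicator_of_notMem h] at hz
    exact hc hz.symm
  have hL : Tendsto (fun n => ∫⁻ x, expNeg (∫⁻ z, s n z ∂(countMeasure x)) ∂Q) atTop
      (𝓝 (∫⁻ x, expNeg (∫⁻ z, f z ∂(countMeasure x)) ∂Q)) := by
    refine tendsto_lintegral_of_dominated_convergence (fun _ => 1) (fun n => ?_)
      (fun n => ae_of_all _ fun x => expNeg_le_one _) (by simp) (ae_of_all _ fun x => ?_)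
    · simp_rw [lintegral_countMeasure _ (s n).measurable]
      exact measurable_expNeg.comp (Measurable.tsum fun i =>
        (s n).measurable.comp (measurable_pi_apply i))
    · exact (continuous_expNeg.tendsto _).comp (lintegral_tendsto_of_tendsto_of_monotone
        (fun n => (s n).measurable.aemeasurable) (ae_of_all _ hmono) (ae_of_all _ hlim))
  refine tendsto_nhds_unique hL ?_
  simp_rw [fun n => hQ.laplace_simple (s n) (hfin n)]
  refine (continuous_expNeg.tendsto _).comp (ENNReal.Tendsto.const_mul ?_ (Or.inr (by simp)))
  refine lintegral_tendsto_of_tendsto_of_monotone (fun n => ?_) (ae_of_all _ fun z m n hmn => ?_)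
    (ae_of_all _ fun z => ?_)
  · exact (measurable_const.sub (measurable_expNeg.comp (s n).measurable)).aemeasurable
  · exact tsub_le_tsub_left (expNeg_strictAnti.antitone (hmono z hmn)) _
  · exact ENNReal.Tendsto.sub tendsto_const_nhds ((continuous_expNeg.tendsto _).comp (hlim z))
      (Or.inl (by simp))

/-! ### Independent marks -/

instance {K : Type} [MeasurableSpace K] (Q : Measure (ℕ → Plane)) [IsProbabilityMeasure Q]
    (ν : Measure K) [IsProbabilityMeasure ν] : IsProbabilityMeasure (markedLaw Q ν) := by
  unfold markedLaw; infer_instance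

/-- Independence factors each finite product of weights, and dominated convergence with bound one
passes to infinitely many marks. The limit form lets the result be matched with another product by
uniqueness of limits. -/
lemma lintegral_expNeg_infinitePi {K : Type} [MeasurableSpace K] (ν : Measure K)
    [IsProbabilityMeasure ν] {f : ℕ → K → ℝ≥0∞} (hf : ∀ i, Measurable (f i)) :
    Tendsto (fun n => ∏ i ∈ Finset.range n, ∫⁻ m, expNeg (f i m) ∂ν) atTop
      (𝓝 (∫⁻ m, expNeg (∑' i, f i (m i)) ∂(Measure.infinitePi fun _ : ℕ => ν))) := by
  have h : ∀ n, ∏ i ∈ Finset.range n, ∫⁻ m, expNeg (f i m) ∂ν =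
      ∫⁻ m, ∏ i ∈ Finset.range n, expNeg (f i (m i)) ∂(Measure.infinitePi fun _ : ℕ => ν) := by
    intro n
    have hi := iIndepFun_infinitePi (P := fun _ : ℕ => ν) (X := fun i m => expNeg (f i m))
      (fun i => measurable_expNeg.comp (hf i))
    rw [lintegral_prod_eq_prod_lintegral_of_indepFun _ _ hi
      (fun i => measurable_expNeg.comp ((hf i).comp (measurable_pi_apply i)))]
    refine Finset.prod_congr rfl fun i _ => ?_
    exact ((measurePreserving_eval_infinitePi (fun _ : ℕ => ν) i).lintegral_comp
      (measurable_expNeg.comp (hf i))).symm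
  simp_rw [h]
  refine tendsto_lintegral_of_dominated_convergence (fun _ => 1) (fun n => ?_)
    (fun n => ae_of_all _ fun x => Finset.prod_le_one' fun i _ => expNeg_le_one _) (by simp)
    (ae_of_all _ fun m => tendsto_prod_expNeg _)
  exact Finset.measurable_prod _ fun i _ =>
    measurable_expNeg.comp ((hf i).comp (measurable_pi_apply i))

/-- The Laplace functional of an independently marked homogeneous Poisson point process. -/
theorem IsHPPP.laplace_marked [IsProbabilityMeasure Q] (hQ : IsHPPP lam Q)
    {K : Type} [MeasurableSpace K] (ν : Measure K) [IsProbabilityMeasure ν]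
    {f : Plane → K → ℝ≥0∞} (hf : Measurable (Function.uncurry f)) :
    ∫⁻ F, expNeg (∑' i, f (F.1 i) (F.2 i)) ∂(markedLaw Q ν) =
      expNeg (ENNReal.ofReal lam * ∫⁻ z, (1 - ∫⁻ m, expNeg (f z m) ∂ν)) := by
  let v : Plane → ℝ≥0∞ := fun z => ∫⁻ m, expNeg (f z m) ∂ν
  have hv : Measurable v := (measurable_expNeg.comp hf).lintegral_prod_right'
  have hv1 : ∀ z, v z ≤ 1 := fun z =>
    (lintegral_mono fun m => expNeg_le_one _).trans (by simp)
  -- With `g = -log v`, averaging out the marks leaves `expNeg (∑' g)`, an unmarked Laplace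
  -- functional.
  let g : Plane → ℝ≥0∞ := fun z => (-(ENNReal.log (v z))).toENNReal
  have hg : Measurable g := by fun_prop
  have hgv : ∀ z, expNeg (g z) = v z := fun z => exists_expNeg_eq (hv1 z)
  have hm : Measurable fun F : Marked K => expNeg (∑' i, f (F.1 i) (F.2 i)) :=
    measurable_expNeg.comp (Measurable.tsum fun i => hf.comp (f := fun F : Marked K => (F.1 i, F.2 i))
      (((measurable_pi_apply i).comp measurable_fst).prodMk
        ((measurable_pi_apply i).comp measurable_snd)))
  rw [markedLaw, lintegral_prod _ hm.aemeasurable]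
  have h : ∀ x : ℕ → Plane, ∫⁻ m, expNeg (∑' i, f (x i) (m i)) ∂(Measure.infinitePi fun _ : ℕ => ν)
      = expNeg (∑' i, g (x i)) := fun x => by
    refine tendsto_nhds_unique (lintegral_expNeg_infinitePi ν (f := fun i m => f (x i) m)
      fun i => hf.comp measurable_prodMk_left) ?_
    refine (tendsto_prod_expNeg _).congr fun n => Finset.prod_congr rfl fun i _ => hgv _
  simp_rw [h, hQ.laplace hg, hgv, v]

end

section

/-! ### Unit exponential random variables -/

lemma ext_of_Ioi {α : Type*} [TopologicalSpace α] {m : MeasurableSpace α}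
    [SecondCountableTopology α] [LinearOrder α] [OrderTopology α] [BorelSpace α] (μ ν : Measure α)
    [IsProbabilityMeasure μ] [IsProbabilityMeasure ν] (h : ∀ a, μ (Ioi a) = ν (Ioi a)) : μ = ν := by
  refine Measure.ext_of_Iic _ _ fun a => ?_
  rw [← compl_Ioi, prob_compl_eq_one_sub measurableSet_Ioi, prob_compl_eq_one_sub measurableSet_Ioi,
    h]

lemma lintegral_exp_mul_Ioi {b : ℝ} (hb : 0 < b) (a : ℝ) :
    ∫⁻ x in Ioi a, ENNReal.ofReal (Real.exp (-(b * x))) = ENNReal.ofReal (Real.exp (-(b * a)) / b) := by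
  have h := integral_exp_mul_Ioi (neg_neg_of_pos hb) a
  simp only [neg_mul, div_neg, neg_div, neg_neg] at h
  rw [← h, ofReal_integral_eq_lintegral_ofReal]
  · exact Integrable.of_integral_ne_zero (by rw [h]; positivity)
  · exact ae_of_all _ fun x => (Real.exp_pos _).le

/-- The exponential law of rate one. -/
noncomputable def expLaw : Measure ℝ :=
  (volume.restrict (Ioi 0)).withDensity fun x => ENNReal.ofReal (Real.exp (-x))

lemma expLaw_Ioi {a : ℝ} (ha : 0 ≤ a) : expLaw (Ioi a) = ENNReal.ofReal (Real.exp (-a)) := by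
  rw [expLaw, withDensity_apply _ measurableSet_Ioi, Measure.restrict_restrict measurableSet_Ioi,
    Ioi_inter_Ioi, max_eq_left ha]
  simpa using lintegral_exp_mul_Ioi one_pos a

instance : IsProbabilityMeasure expLaw := by
  constructor
  rw [expLaw, withDensity_apply _ MeasurableSet.univ, Measure.restrict_univ]
  simpa using lintegral_exp_mul_Ioi one_pos 0

variable {K : Type} [MeasurableSpace K] {ν : Measure K} {G : K → ℝ≥0∞}

/-- `G` is exponentially distributed with mean one under `ν`. -/
def IsUnitExp (G : K → ℝ≥0∞) (ν : Measure K) : Prop := ∀ c, ν {m | c < G m} = expNeg c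

lemma IsUnitExp.congr {G' : K → ℝ≥0∞} (h : IsUnitExp G ν) (hG : G' =ᵐ[ν] G) : IsUnitExp G' ν :=
  fun c => by
    rw [← h c]
    refine measure_congr ?_
    filter_upwards [hG] with m hm
    exact propext (by change c < G' m ↔ c < G m; rw [hm])

lemma IsUnitExp.comp {K' : Type} [MeasurableSpace K'] {ν' : Measure K'} {g : K' → K}
    (h : IsUnitExp G ν) (hG : Measurable G) (hg : MeasurePreserving g ν' ν) :
    IsUnitExp (fun m => G (g m)) ν' := fun c => by
  rw [← h c]
  exact hg.measure_preimage (measurableSet_lt measurable_const hG).nullMeasurableSet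

lemma IsUnitExp.map_eq [IsProbabilityMeasure ν] (h : IsUnitExp G ν) (hG : Measurable G) :
    ν.map G = expLaw.map ENNReal.ofReal := by
  have := Measure.isProbabilityMeasure_map (μ := ν) hG.aemeasurable
  have := Measure.isProbabilityMeasure_map (μ := expLaw) ENNReal.measurable_ofReal.aemeasurable
  refine ext_of_Ioi _ _ fun c => ?_
  rw [Measure.map_apply hG measurableSet_Ioi,
    Measure.map_apply ENNReal.measurable_ofReal measurableSet_Ioi]
  refine (h c).trans ?_
  rcases eq_or_ne c ∞ with rfl | hc
  · simp
  · have : ENNReal.ofReal ⁻¹' Ioi c = Ioi c.toReal := by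
      ext x
      simp [ENNReal.lt_ofReal_iff_toReal_lt hc]
    rw [this, expLaw_Ioi ENNReal.toReal_nonneg, ← expNeg_ofReal ENNReal.toReal_nonneg,
      ENNReal.ofReal_toReal hc]

/-- The Laplace transform of the exponential law. -/
lemma IsUnitExp.laplace [IsProbabilityMeasure ν] (h : IsUnitExp G ν) (hG : Measurable G)
    (c : ℝ≥0∞) : ∫⁻ m, expNeg (c * G m) ∂ν = (1 + c)⁻¹ := by
  have hm : Measurable fun t : ℝ≥0∞ => expNeg (c * t) := by fun_prop
  rw [← lintegral_map (f := fun t => expNeg (c * t)) hm hG, h.map_eq hG,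
    lintegral_map hm ENNReal.measurable_ofReal, expLaw,
    lintegral_withDensity_eq_lintegral_mul _ (by fun_prop)
      (g := fun a => expNeg (c * ENNReal.ofReal a)) (by fun_prop)]
  -- For `c = ∞` the integrand vanishes on `x > 0`, in agreement with `(1 + ∞)⁻¹ = 0`.
  rcases eq_or_ne c ∞ with rfl | hc
  · rw [setLIntegral_congr_fun (g := fun _ => 0) measurableSet_Ioi fun x hx => ?_]
    · simp
    · simp [ENNReal.top_mul (ENNReal.ofReal_pos.2 hx).ne']
  · lift c to ℝ≥0 using hc
    have hc0 : (0 : ℝ) < 1 + c := by positivity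
    rw [setLIntegral_congr_fun (g := fun x => ENNReal.ofReal (Real.exp (-((1 + c) * x))))
      measurableSet_Ioi fun x hx => ?_, lintegral_exp_mul_Ioi hc0]
    · rw [mul_zero, neg_zero, Real.exp_zero, one_div, ENNReal.ofReal_inv_of_pos hc0,
        ENNReal.ofReal_add zero_le_one c.coe_nonneg]
      simp
    · have hx' : (0 : ℝ) ≤ x := le_of_lt hx
      simp only [Pi.mul_apply]
      rw [← ENNReal.ofReal_coe_nnreal, ← ENNReal.ofReal_mul c.coe_nonneg,
        expNeg_ofReal (by positivity), ← ENNReal.ofReal_mul (Real.exp_pos _).le, ← Real.exp_add]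
      ring_nf

/-! ### Rayleigh fading -/

@[fun_prop] lemma measurable_gain : Measurable gain := by unfold gain; fun_prop

lemma gain_mul (z w : ℂ) : gain (z * w) = gain z * gain w := by
  rw [gain, gain, gain, ← ENNReal.ofReal_mul (by positivity), norm_mul, mul_pow]

lemma lintegral_mul_exp_neg_sq (a : ℝ) (ha : 0 ≤ a) :
    ∫⁻ r in Ioi a, ENNReal.ofReal (2 * r * Real.exp (-r ^ 2)) = ENNReal.ofReal (Real.exp (-a ^ 2)) := by
  have hd : ∀ r ∈ Ici a, HasDerivAt (fun r => -Real.exp (-r ^ 2)) (2 * r * Real.exp (-r ^ 2)) r := by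
    intro r _
    have h := ((hasDerivAt_pow 2 r).fun_neg.exp).fun_neg
    have e : -(Real.exp (-r ^ 2) * -((2 : ℕ) * r ^ (2 - 1))) = 2 * r * Real.exp (-r ^ 2) := by
      norm_num
      ring
    rwa [e] at h
  have hpos : ∀ r ∈ Ioi a, 0 ≤ 2 * r * Real.exp (-r ^ 2) := fun r hr => by
    have : 0 ≤ r := ha.trans (le_of_lt hr)
    positivity
  have hl : Tendsto (fun r : ℝ => -Real.exp (-r ^ 2)) atTop (𝓝 0) := by
    simpa using (Real.tendsto_exp_neg_atTop_nhds_zero.comp (tendsto_pow_atTop two_ne_zero)).neg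
  have h := integral_Ioi_of_hasDerivAt_of_nonneg' hd hpos hl
  rw [zero_sub, neg_neg] at h
  rw [← h, ofReal_integral_eq_lintegral_ofReal (integrableOn_Ioi_deriv_of_nonneg' hd hpos hl)]
  exact (ae_restrict_iff' measurableSet_Ioi).2 (ae_of_all _ hpos)

/-- The power gain of a Rayleigh fading coefficient is exponentially distributed. -/
theorem isUnitExp_gain : IsUnitExp gain rayleigh := by
  intro c
  rcases eq_or_ne c ∞ with rfl | hc
  · simp
  lift c to ℝ≥0 using hc
  have hms : MeasurableSet {z | (c : ℝ≥0∞) < gain z} := measurableSet_lt measurable_const measurable_gain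
  have hv : (1 / 2 : ℝ≥0) ≠ 0 := by norm_num
  have hm := Complex.measurableEquivRealProd.symm.measurable
  rw [rayleigh, Measure.map_apply hm hms, gaussianReal_of_var_ne_zero _ hv,
    prod_withDensity (measurable_gaussianPDF _ _) (measurable_gaussianPDF _ _),
    withDensity_apply _ (hm hms), ← lintegral_indicator (hm hms), ← Measure.volume_eq_prod,
    ← lintegral_comp_polarCoord_symm, polarCoord_target, Measure.volume_eq_prod,
    ← Measure.prod_restrict]
  -- In polar coordinates the Gaussian density is rotation invariant, and the event constrains only
  -- the radius, through `r > √c`. The integrand thus splits into a radial density and the uniform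
  -- density `1 / (2π)` in the angle.
  have key : ∀ p ∈ Ioi (0 : ℝ) ×ˢ Ioo (-Real.pi) Real.pi,
      ENNReal.ofReal p.1 • (Complex.measurableEquivRealProd.symm ⁻¹' {z | (c : ℝ≥0∞) < gain z}).indicator
        (fun z => gaussianPDF 0 (1 / 2) z.1 * gaussianPDF 0 (1 / 2) z.2) (polarCoord.symm p) =
      (Ioi (√c)).indicator (fun r => ENNReal.ofReal (2 * r * Real.exp (-r ^ 2))) p.1 *
        ENNReal.ofReal (1 / (2 * Real.pi)) := by
    rintro ⟨r, θ⟩ ⟨hr, -⟩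
    have hr : 0 < r := hr
    have hiff : polarCoord.symm (r, θ) ∈
        Complex.measurableEquivRealProd.symm ⁻¹' {z | (c : ℝ≥0∞) < gain z} ↔ r ∈ Ioi √c := by
      have e : Complex.measurableEquivRealProd.symm (polarCoord.symm (r, θ)) =
        ⟨r * Real.cos θ, r * Real.sin θ⟩ := rfl
      have e2 : ‖(⟨r * Real.cos θ, r * Real.sin θ⟩ : ℂ)‖ ^ 2 = r ^ 2 := by
        rw [← Complex.normSq_eq_norm_sq, Complex.normSq_mk]
        linear_combination r ^ 2 * Real.sin_sq_add_cos_sq θ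
      rw [mem_preimage, e, mem_ofPred_eq, gain, e2, ENNReal.lt_ofReal_iff_toReal_lt (by simp),
        mem_Ioi, Real.sqrt_lt' hr]
      simp
    by_cases h : r ∈ Ioi √(c : ℝ)
    · rw [indicator_of_mem (hiff.2 h), indicator_of_mem h, gaussianPDF_def, smul_eq_mul]
      simp only [polarCoord_symm_apply, gaussianPDFReal_def]
      rw [← ENNReal.ofReal_mul (by positivity), ← ENNReal.ofReal_mul hr.le,
        ← ENNReal.ofReal_mul (by positivity)]
      congr 1
      have h1 : (√(2 * Real.pi * ((1 / 2 : ℝ≥0) : ℝ)))⁻¹ * (√(2 * Real.pi * ((1 / 2 : ℝ≥0) : ℝ)))⁻¹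
          = 1 / Real.pi := by
        rw [← mul_inv, Real.mul_self_sqrt (by positivity)]
        push_cast
        field_simp
      have h2 : Real.exp (-(r * Real.cos θ - 0) ^ 2 / (2 * ((1 / 2 : ℝ≥0) : ℝ))) *
          Real.exp (-(r * Real.sin θ - 0) ^ 2 / (2 * ((1 / 2 : ℝ≥0) : ℝ))) = Real.exp (-r ^ 2) := by
        rw [← Real.exp_add]
        congr 1
        push_cast
        linear_combination -r ^ 2 * Real.sin_sq_add_cos_sq θ
      rw [mul_mul_mul_comm, h1, h2]
      field_simp
    · rw [indicator_of_notMem (hiff.not.2 h), indicator_of_notMem h]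
      simp
  rw [Measure.prod_restrict, setLIntegral_congr_fun (measurableSet_Ioi.prod measurableSet_Ioo) key,
    ← Measure.prod_restrict, lintegral_prod_mul (f := fun r => (Ioi √(c : ℝ)).indicator
      (fun r => ENNReal.ofReal (2 * r * Real.exp (-r ^ 2))) r)
      (g := fun _ => ENNReal.ofReal (1 / (2 * Real.pi)))
      ((Measurable.indicator (by fun_prop) measurableSet_Ioi).aemeasurable) (by fun_prop),
    lintegral_indicator measurableSet_Ioi, Measure.restrict_restrict measurableSet_Ioi,
    Ioi_inter_Ioi, max_eq_left (Real.sqrt_nonneg _),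
    lintegral_mul_exp_neg_sq _ (Real.sqrt_nonneg _), lintegral_const, Measure.restrict_apply_univ,
    Real.volume_Ioo, Real.sq_sqrt c.coe_nonneg, ← ENNReal.ofReal_mul (by positivity),
    ← expNeg_ofReal c.coe_nonneg, ENNReal.ofReal_coe_nnreal]
  have : 1 / (2 * Real.pi) * (Real.pi - -Real.pi) = 1 := by field_simp; norm_num
  rw [this]
  simp

lemma ae_ne_zero_rayleigh : ∀ᵐ z ∂rayleigh, z ≠ 0 := by
  have h := isUnitExp_gain 0
  rw [expNeg_zero, ← mem_ae_iff_prob_eq_one (measurableSet_lt measurable_const measurable_gain)] at h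
  filter_upwards [h] with z hz hz0
  simp [gain, hz0] at hz

lemma measurePreserving_eval_rayleighVec {M : ℕ} (i : Fin M) :
    MeasurePreserving (fun h : Fin M → ℂ => h i) (rayleighVec M) rayleigh :=
  measurePreserving_eval (fun _ : Fin M => rayleigh) i

lemma measurePreserving_eval_rayleighMat {M : ℕ} (i : Fin M) :
    MeasurePreserving (fun h : Fin M → Fin M → ℂ => h i) (rayleighMat M) (rayleighVec M) :=
  measurePreserving_eval (fun _ : Fin M => rayleighVec M) i

lemma ae_ne_zero_rayleighVec {M : ℕ} (i : Fin M) : ∀ᵐ h ∂rayleighVec M, h i ≠ 0 :=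
  (measurePreserving_eval_rayleighVec i).quasiMeasurePreserving.ae ae_ne_zero_rayleigh

/-! ### Integrals over the plane of radial functions -/

lemma lintegral_fun_norm {f : ℝ → ℝ≥0∞} (hf : Measurable f) :
    ∫⁻ x : Plane, f ‖x‖ = ENNReal.ofReal (2 * Real.pi) * ∫⁻ r in Ioi (0 : ℝ), ENNReal.ofReal r * f r := by
  have hd : Module.finrank ℝ Plane = 2 := by simp
  calc
    ∫⁻ x : Plane, f ‖x‖ = ∫⁻ x : ({(0)}ᶜ : Set Plane), f (‖x.1‖) ∂((volume : Measure Plane).comap (↑)) := by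
      rw [lintegral_subtype_comap (measurableSet_singleton _).compl fun x => f (‖x‖),
        restrict_compl_singleton]
    _ = ∫⁻ x, f x.2 ∂(volume : Measure Plane).toSphere.prod
          (.volumeIoiPow (Module.finrank ℝ Plane - 1)) := by
      simpa using (volume : Measure Plane).measurePreserving_homeomorphUnitSphereProd.lintegral_comp
        (f := fun x => f x.2) (by fun_prop)
    _ = (volume : Measure Plane).toSphere univ *
          ∫⁻ x : Ioi (0 : ℝ), f x ∂.volumeIoiPow (Module.finrank ℝ Plane - 1) := by
      rw [lintegral_prod _ (by fun_prop)]
      simp [mul_comm]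
    _ = _ := by
      rw [Measure.volumeIoiPow, lintegral_withDensity_eq_lintegral_mul _ (by fun_prop) (by fun_prop),
        Measure.toSphere_apply_univ, hd, EuclideanSpace.volume_ball_fin_two]
      rw [show ((fun r : Ioi (0 : ℝ) => ENNReal.ofReal ((r : ℝ) ^ (2 - 1))) * fun x : Ioi (0 : ℝ) => f x) =
        fun r : Ioi (0 : ℝ) => (fun r : ℝ => ENNReal.ofReal r * f r) r by ext; simp,
        lintegral_subtype_comap measurableSet_Ioi fun r : ℝ => ENNReal.ofReal r * f r]
      rw [ENNReal.ofReal_mul zero_le_two]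
      simp

lemma lintegral_rpow_mul_exp_neg_mul_rpow {p q b : ℝ} (hp : 0 < p) (hq : -1 < q) (hb : 0 < b) :
    ∫⁻ x in Ioi (0 : ℝ), ENNReal.ofReal (x ^ q * Real.exp (-b * x ^ p)) =
      ENNReal.ofReal (b ^ (-(q + 1) / p) * (1 / p) * Real.Gamma ((q + 1) / p)) := by
  have h := integral_rpow_mul_exp_neg_mul_rpow hp hq hb
  have hpos : 0 < Real.Gamma ((q + 1) / p) := Real.Gamma_pos_of_pos (div_pos (by linarith) hp)
  rw [← h, ofReal_integral_eq_lintegral_ofReal]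
  · exact Integrable.of_integral_ne_zero (by rw [h]; positivity)
  · refine (ae_restrict_iff' measurableSet_Ioi).2 (ae_of_all _ fun x hx => ?_)
    have : (0 : ℝ) < x := hx
    positivity

lemma lintegral_expNeg_mul_norm_sq {c : ℝ} (hc : 0 < c) :
    ∫⁻ x : Plane, expNeg (ENNReal.ofReal (c * ‖x‖ ^ 2)) = ENNReal.ofReal (Real.pi / c) := by
  have h := lintegral_rpow_mul_exp_neg_mul_rpow (p := 2) (q := 1) two_pos (by norm_num) hc
  rw [lintegral_fun_norm (f := fun r => expNeg (ENNReal.ofReal (c * r ^ 2))) (by fun_prop),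
    setLIntegral_congr_fun (g := fun r => ENNReal.ofReal (r ^ (1 : ℝ) * Real.exp (-c * r ^ (2 : ℝ))))
      measurableSet_Ioi fun r hr => ?_, h, ← ENNReal.ofReal_mul (by positivity)]
  · congr 1
    norm_num
    rw [Real.rpow_neg_one]
    ring
  · have hr' : (0 : ℝ) < r := hr
    rw [expNeg_ofReal (by positivity), ← ENNReal.ofReal_mul hr'.le]
    norm_num

lemma one_sub_inv_one_add {c : ℝ} (hc : 0 ≤ c) :
    1 - (1 + ENNReal.ofReal c)⁻¹ = ENNReal.ofReal (c / (1 + c)) := by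
  rw [← ENNReal.ofReal_one, ← ENNReal.ofReal_add zero_le_one hc,
    ← ENNReal.ofReal_inv_of_pos (by positivity), ← ENNReal.ofReal_sub _ (by positivity)]
  congr 1
  field_simp
  ring

/-- Translation moves `y` to the origin, and polar coordinates leave the factor `s / (s + r^α)`.
Writing it as `∫ s exp(-(s + r^α) u) du` and exchanging the integrals gives two Gamma integrals, in
`r` and then in `u`. The second converges at `u = 0` because `2 / α < 1`. -/
lemma lintegral_pathLoss {α s : ℝ} (hα : 2 < α) (hs : 0 < s) (y : Plane) :
    ∫⁻ x : Plane, (1 - (1 + ENNReal.ofReal s * pathLoss α x y)⁻¹) =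
      ENNReal.ofReal (Real.pi * Real.Gamma (1 + 2 / α) * Real.Gamma (1 - 2 / α) * s ^ (2 / α)) := by
  have hα0 : 0 < α := by linarith
  have hk : 2 / α < 1 := (div_lt_one hα0).2 hα
  have hk0 : 0 < 2 / α := by positivity
  simp only [pathLoss, dist_eq_norm]
  rw [lintegral_sub_right_eq_self
    (fun x : Plane => 1 - (1 + ENNReal.ofReal s * ENNReal.ofReal ‖x‖ ^ (-α))⁻¹) y,
    lintegral_fun_norm (f := fun r => 1 - (1 + ENNReal.ofReal s * ENNReal.ofReal r ^ (-α))⁻¹)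
      (by fun_prop)]
  have h1 : ∀ r ∈ Ioi (0 : ℝ),
      ENNReal.ofReal r * (1 - (1 + ENNReal.ofReal s * ENNReal.ofReal r ^ (-α))⁻¹) =
      ∫⁻ u in Ioi (0 : ℝ), ENNReal.ofReal (s * Real.exp (-(s * u))) *
        ENNReal.ofReal (r ^ (1 : ℝ) * Real.exp (-u * r ^ α)) := by
    intro r hr
    have hr : 0 < r := hr
    have hra : 0 < r ^ α := Real.rpow_pos_of_pos hr _
    rw [ENNReal.ofReal_rpow_of_pos hr, ← ENNReal.ofReal_mul hs.le,
      one_sub_inv_one_add (by positivity), ← ENNReal.ofReal_mul hr.le]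
    have : ∀ u : ℝ, ENNReal.ofReal (s * Real.exp (-(s * u))) *
        ENNReal.ofReal (r ^ (1 : ℝ) * Real.exp (-u * r ^ α)) =
        ENNReal.ofReal (s * r) * ENNReal.ofReal (Real.exp (-((s + r ^ α) * u))) := fun u => by
      rw [← ENNReal.ofReal_mul (by positivity), ← ENNReal.ofReal_mul (by positivity), Real.rpow_one,
        show -((s + r ^ α) * u) = -(s * u) + -u * r ^ α by ring, Real.exp_add]
      ring_nf
    simp_rw [this]
    rw [lintegral_const_mul _ (by fun_prop), lintegral_exp_mul_Ioi (by positivity),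
      ← ENNReal.ofReal_mul (by positivity), Real.rpow_neg hr.le]
    congr 1
    simp only [mul_zero, neg_zero, Real.exp_zero]
    field_simp
    ring
  rw [setLIntegral_congr_fun measurableSet_Ioi h1, lintegral_lintegral_swap (by fun_prop)]
  have h2 : ∀ u ∈ Ioi (0 : ℝ), ∫⁻ r in Ioi (0 : ℝ), ENNReal.ofReal (s * Real.exp (-(s * u))) *
        ENNReal.ofReal (r ^ (1 : ℝ) * Real.exp (-u * r ^ α)) =
      ENNReal.ofReal (s * (1 / α * Real.Gamma (2 / α))) *
        ENNReal.ofReal (u ^ (-(2 / α)) * Real.exp (-s * u ^ (1 : ℝ))) := by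
    intro u hu
    have hu : 0 < u := hu
    have hg : 0 < Real.Gamma (2 / α) := Real.Gamma_pos_of_pos hk0
    rw [lintegral_const_mul _ (by fun_prop),
      lintegral_rpow_mul_exp_neg_mul_rpow hα0 (by norm_num) hu, ← ENNReal.ofReal_mul (by positivity),
      ← ENNReal.ofReal_mul (by positivity), Real.rpow_one, show (1 + 1 : ℝ) = 2 by norm_num,
      neg_div, neg_mul]
    ring_nf
  rw [setLIntegral_congr_fun measurableSet_Ioi h2, lintegral_const_mul _ (by fun_prop),
    lintegral_rpow_mul_exp_neg_mul_rpow one_pos (by linarith) hs, ← ENNReal.ofReal_mul (by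
      have := Real.Gamma_pos_of_pos hk0
      positivity), ← ENNReal.ofReal_mul (by positivity)]
  congr 1
  rw [add_comm 1 (2 / α), Real.Gamma_add_one hk0.ne', show (-(2 / α) + 1) / 1 = 1 - 2 / α by ring,
    show -(-(2 / α) + 1) / 1 = 2 / α - 1 by ring, Real.rpow_sub_one hs.ne']
  field_simp

end

section

/-! ### The nearest point of a Poisson point process -/

lemma measurable_nearest : Measurable nearest := by
  classical
  let p : ℕ → (ℕ → Plane) → Prop := fun n x => ∀ m, ‖x n‖ ≤ ‖x m‖
  have hp : ∀ n, MeasurableSet {x | p n x} := fun n => by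
    simp only [p, ofPred_forall]
    exact MeasurableSet.iInter fun m => measurableSet_le (by fun_prop) (by fun_prop)
  have hA : MeasurableSet {x | ∃ n, p n x} := by
    rw [ofPred_exists]
    exact MeasurableSet.iUnion hp
  -- The second disjunct makes the search succeed for every configuration, so `Nat.find` is total.
  -- It changes nothing when a nearest point exists.
  have hq : ∀ n, MeasurableSet {x | p n x ∨ ¬ ∃ k, p k x} := fun n => (hp n).union hA.compl
  have hex : ∀ x, ∃ n, p n x ∨ ¬ ∃ k, p k x := fun x => by
    by_cases h : ∃ k, p k x
    · exact h.imp fun n hn => Or.inl hn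
    · exact ⟨0, Or.inr h⟩
  have hm := Measurable.find (f := fun n (x : ℕ → Plane) => x n) (fun n => measurable_pi_apply n) hq hex
  have hite : Measurable fun x => if ∃ n, p n x then x (Nat.find (hex x)) else (0 : Plane) :=
    Measurable.ite hA hm measurable_const
  refine Eq.subst (motive := Measurable) (funext fun x => Eq.symm ?_) hite
  unfold nearest
  by_cases h : ∃ n, p n x
  · rw [dif_pos h, if_pos h]
    congr 1
    refine Nat.find_congr' fun {n} => ?_
    simp [h, p]
  · rw [dif_neg h, if_neg h]

variable {lam : ℝ} {Q : Measure (ℕ → Plane)}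

lemma IsHPPP.ae_count_lt_top (hQ : IsHPPP lam Q) {B : Set Plane} (hB : MeasurableSet B)
    (hf : volume B ≠ ∞) : ∀ᵐ x ∂Q, {n | x n ∈ B}.Finite := by
  have h := hQ.poisson B hB hf
  have h0 : Q {x | numPoints B x = ⊤} = 0 := by
    rw [h.measure_eq (p := fun k => k = ⊤) (measurableSet_singleton _),
      Measure.map_apply (measurable_of_countable _) MeasurableSet.of_discrete,
      show (fun k : ℕ => (k : ℕ∞)) ⁻¹' {x | x = ⊤} = ∅ from
        eq_empty_of_forall_notMem ENat.natCast_ne_top,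
      measure_empty]
  have h1 : ∀ᵐ x ∂Q, numPoints B x ≠ ⊤ := by
    rw [ae_iff]
    simpa using h0
  filter_upwards [h1] with x hx
  exact encard_ne_top_iff.1 hx

/-- Almost surely a ball containing the point of index `0` contains finitely many points. The
minimum over these is a global one. -/
lemma IsHPPP.ae_exists_nearest (hQ : IsHPPP lam Q) : ∀ᵐ x ∂Q, ∃ n, ∀ m, ‖x n‖ ≤ ‖x m‖ := by
  have h : ∀ᵐ x ∂Q, ∀ R : ℕ, {n | x n ∈ Metric.closedBall (0 : Plane) R}.Finite :=
    ae_all_iff.2 fun R => hQ.ae_count_lt_top Metric.isClosed_closedBall.measurableSet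
      measure_closedBall_lt_top.ne
  filter_upwards [h] with x hx
  obtain ⟨R, hR⟩ := exists_nat_ge ‖x 0‖
  obtain ⟨n, hn, hmin⟩ := Set.exists_min_image _ (fun n => ‖x n‖) (hx R) ⟨0, by simpa using hR⟩
  refine ⟨n, fun m => ?_⟩
  by_cases hm : x m ∈ Metric.closedBall (0 : Plane) R
  · exact hmin m hm
  · have h1 : ‖x n‖ ≤ R := by simpa using hn
    have h2 : (R : ℝ) < ‖x m‖ := by simpa using hm
    linarith

lemma lt_norm_nearest_iff {x : ℕ → Plane} (hx : ∃ n, ∀ m, ‖x n‖ ≤ ‖x m‖) (r : ℝ) :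
    r < ‖nearest x‖ ↔ ∀ n, r < ‖x n‖ := by
  classical
  have h : nearest x = x (Nat.find hx) := by
    rw [nearest, dif_pos hx]
  rw [h]
  exact ⟨fun hr n => hr.trans_le (Nat.find_spec hx n), fun hr => hr _⟩

/-- The Laplace transform of the count at `c = ∞` is the void probability. -/
lemma IsHPPP.measure_count_eq_zero (hQ : IsHPPP lam Q) {B : Set Plane} (hB : MeasurableSet B)
    (hf : volume B ≠ ∞) :
    Q {x | ∀ n, x n ∉ B} = expNeg (ENNReal.ofReal lam * volume B) := by
  have h := hQ.lintegral_expNeg_count ∞ hB hf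
  rw [expNeg_top, tsub_zero, mul_one] at h
  have hm : MeasurableSet {x : ℕ → Plane | ∀ n, x n ∉ B} := by
    rw [ofPred_forall]
    exact MeasurableSet.iInter fun n => hB.compl.preimage (measurable_pi_apply n)
  rw [← h, ← lintegral_indicator_one hm]
  refine lintegral_congr fun x => ?_
  rw [countMeasure_apply x hB, numPoints]
  by_cases hx : ∀ n, x n ∉ B
  · rw [indicator_of_mem (show x ∈ {x : ℕ → Plane | ∀ n, x n ∉ B} from hx),
      show {n | x n ∈ B} = ∅ from eq_empty_of_forall_notMem hx]
    simp
  · rw [indicator_of_notMem (show x ∉ {x : ℕ → Plane | ∀ n, x n ∉ B} from hx)]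
    push Not at hx
    rw [ENNReal.top_mul, expNeg_top]
    simpa [encard_eq_zero, eq_empty_iff_forall_notMem] using hx

/-- The area of the disc up to the nearest point, in units of the mean cell area, is exponentially
distributed. -/
theorem IsHPPP.isUnitExp_nearest (hQ : IsHPPP lam Q) (hlam : 0 < lam) :
    IsUnitExp (fun x => ENNReal.ofReal (Real.pi * lam * ‖nearest x‖ ^ 2)) Q := by
  intro c
  rcases eq_or_ne c ∞ with rfl | hc
  · simp
  have hpl : 0 < Real.pi * lam := by positivity
  have hc0 : 0 ≤ c.toReal / (Real.pi * lam) := div_nonneg ENNReal.toReal_nonneg hpl.le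
  -- The radius for which the expected number of points in the disc is exactly `c`.
  set r : ℝ := √(c.toReal / (Real.pi * lam)) with hr
  have h := hQ.measure_count_eq_zero (B := Metric.closedBall (0 : Plane) r)
    Metric.isClosed_closedBall.measurableSet measure_closedBall_lt_top.ne
  have e : ENNReal.ofReal lam * volume (Metric.closedBall (0 : Plane) r) = c := by
    rw [EuclideanSpace.volume_closedBall_fin_two, ← ENNReal.ofReal_pow (Real.sqrt_nonneg _),
      Real.sq_sqrt hc0, ← ENNReal.ofReal_mul hc0, ← ENNReal.ofReal_mul hlam.le,
      ← ENNReal.ofReal_toReal hc]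
    congr 1
    rw [ENNReal.toReal_ofReal ENNReal.toReal_nonneg]
    field_simp
  rw [e] at h
  rw [← h]
  refine measure_congr ?_
  filter_upwards [hQ.ae_exists_nearest] with x hx
  refine propext ?_
  change c < ENNReal.ofReal (Real.pi * lam * ‖nearest x‖ ^ 2) ↔ ∀ n, x n ∉ Metric.closedBall 0 r
  have h2 : (∀ n, x n ∉ Metric.closedBall 0 r) ↔ r < ‖nearest x‖ := by
    rw [lt_norm_nearest_iff hx]
    simp
  rw [h2, ENNReal.lt_ofReal_iff_toReal_lt hc, hr, Real.sqrt_lt hc0 (norm_nonneg _),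
    div_lt_iff₀ hpl, mul_comm (Real.pi * lam)]

lemma IsHPPP.ae_nearest_ne_zero [IsProbabilityMeasure Q] (hQ : IsHPPP lam Q) (hlam : 0 < lam) :
    ∀ᵐ x ∂Q, nearest x ≠ 0 := by
  have h := hQ.isUnitExp_nearest hlam 0
  have hm := measurable_nearest
  rw [expNeg_zero, ← mem_ae_iff_prob_eq_one (measurableSet_lt measurable_const (by fun_prop))] at h
  filter_upwards [h] with x hx hx0
  simp [hx0] at hx

/-! ### Interference -/

@[fun_prop] lemma Measurable.pathLoss {Ω : Type*} [MeasurableSpace Ω] {α : ℝ} {x y : Ω → Plane}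
    (hx : Measurable x) (hy : Measurable y) : Measurable fun ω => pathLoss α (x ω) (y ω) := by
  unfold WSN.pathLoss
  fun_prop

/-- The Laplace transform of `I` under `ρ` is that of the interference from a Poisson field of
transmitters with path-loss exponent `α`. -/
def HasInterfLaw (α Λ : ℝ) {J : Type} [MeasurableSpace J] (I : J → ℝ≥0∞) (ρ : Measure J) : Prop :=
  ∀ s : ℝ, 0 < s →
    ∫⁻ q, expNeg (ENNReal.ofReal s * I q) ∂ρ = expNeg (ENNReal.ofReal (Λ * s ^ (2 / α)))

/-- The contribution to the interference constant of a field of unit intensity and unit power. -/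
noncomputable def interfConst (α : ℝ) : ℝ :=
  Real.pi * Real.Gamma (1 + 2 / α) * Real.Gamma (1 - 2 / α)

lemma interfConst_pos {α : ℝ} (hα : 2 < α) : 0 < interfConst α := by
  have hα0 : 0 < α := by linarith
  have h1 : 2 / α < 1 := (div_lt_one hα0).2 hα
  have h2 : 0 < Real.Gamma (1 + 2 / α) := Real.Gamma_pos_of_pos (by positivity)
  have h3 : 0 < Real.Gamma (1 - 2 / α) := Real.Gamma_pos_of_pos (by linarith)
  unfold interfConst
  positivity

/-- Integrating an exponential mark turns the weight of a transmitter into `(1 + s · pathLoss)⁻¹`.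
The marked Laplace functional and `lintegral_pathLoss` then give the exponent. -/
theorem IsHPPP.hasInterfLaw [IsProbabilityMeasure Q] (hQ : IsHPPP lam Q) (hlam : 0 < lam)
    {K : Type} [MeasurableSpace K] {ν : Measure K} [IsProbabilityMeasure ν] {G : K → ℝ≥0∞}
    (hGm : Measurable G) (hG : IsUnitExp G ν) {α : ℝ} (hα : 2 < α) (y : Plane) :
    HasInterfLaw α (lam * interfConst α)
      (fun F : Marked K => ∑' i, G (F.2 i) * pathLoss α (F.1 i) y) (markedLaw Q ν) := by
  intro s hs
  simp_rw [← ENNReal.tsum_mul_left]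
  rw [hQ.laplace_marked ν (f := fun x m => ENNReal.ofReal s * (G m * pathLoss α x y)) (by fun_prop)]
  have h : ∀ z, ∫⁻ m, expNeg (ENNReal.ofReal s * (G m * pathLoss α z y)) ∂ν =
      (1 + ENNReal.ofReal s * pathLoss α z y)⁻¹ := fun z => by
    rw [← hG.laplace hGm]
    refine lintegral_congr fun m => ?_
    ring_nf
  simp_rw [h]
  rw [lintegral_pathLoss hα hs, ← ENNReal.ofReal_mul hlam.le, interfConst, mul_assoc lam]

variable {α Λ : ℝ} {J J' : Type} [MeasurableSpace J] [MeasurableSpace J'] {I : J → ℝ≥0∞}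
  {I' : J' → ℝ≥0∞} {ρ : Measure J} {ρ' : Measure J'} [IsProbabilityMeasure ρ']

/-- The input laws are nested products with the eavesdroppers in the last factor. This carries that
factor along. -/
lemma HasInterfLaw.fst (h : HasInterfLaw α Λ I ρ) (hI : Measurable I) :
    HasInterfLaw α Λ (fun q : J × J' => I q.1) (ρ.prod ρ') := fun s hs => by
  rw [lintegral_prod _ (by fun_prop)]
  simpa using h s hs

/-- Laplace transforms of independent fields multiply, and rescaling power by `μ` replaces `s` by `s
μ`. Both exponents are multiples of `s^(2/α)`, so the constants add with weight `μ^(2/α)`. -/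
lemma HasInterfLaw.add {Λ' μ : ℝ} (h : HasInterfLaw α Λ I ρ) (h' : HasInterfLaw α Λ' I' ρ')
    (hI : Measurable I) (hI' : Measurable I') (hΛ : 0 ≤ Λ) (hΛ' : 0 ≤ Λ') (hμ : 0 < μ) :
    HasInterfLaw α (Λ + Λ' * μ ^ (2 / α)) (fun q : J × J' => I q.1 + ENNReal.ofReal μ * I' q.2)
      (ρ.prod ρ') := fun s hs => by
  simp_rw [mul_add, expNeg_add, ← mul_assoc, ← ENNReal.ofReal_mul hs.le]
  rw [lintegral_prod_mul (f := fun q => expNeg (ENNReal.ofReal s * I q))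
    (g := fun q => expNeg (ENNReal.ofReal (s * μ) * I' q)) (by fun_prop) (by fun_prop), h s hs,
    h' _ (mul_pos hs hμ), ← expNeg_add, ← ENNReal.ofReal_add (by positivity) (by positivity),
    Real.mul_rpow hs.le hμ.le]
  ring_nf

/-! ### Signal-to-interference ratios -/

variable [IsProbabilityMeasure ρ]

/-- The signal-to-interference ratio of a link with Rayleigh fading and fixed endpoints. -/
lemma HasInterfLaw.measure_lt_sir (h : HasInterfLaw α Λ I ρ) (hI : Measurable I) (hα : 0 < α)
    {K : Type} [MeasurableSpace K] {ν : Measure K} [IsProbabilityMeasure ν] {G : K → ℝ≥0∞}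
    (hGm : Measurable G) (hG : IsUnitExp G ν) {x : Plane} (hx : x ≠ 0) {t : ℝ} (ht : 0 < t) :
    (ν.prod ρ) {q | ENNReal.ofReal t < G q.1 * pathLoss α 0 x / I q.2} =
      expNeg (ENNReal.ofReal (Λ * t ^ (2 / α) * ‖x‖ ^ 2)) := by
  have hx' : 0 < ‖x‖ := norm_pos_iff.2 hx
  have hp : pathLoss α 0 x = ENNReal.ofReal (‖x‖ ^ (-α)) := by
    rw [pathLoss, dist_zero_left, ENNReal.ofReal_rpow_of_pos hx']
  have hp0 : 0 < ‖x‖ ^ (-α) := Real.rpow_pos_of_pos hx' _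
  have hpa : 0 < ‖x‖ ^ α := Real.rpow_pos_of_pos hx' _
  -- Isolating the gain turns the event into an exponential tail at level `t ‖x‖^α I`. The
  -- equivalence also covers interference equal to `0` or `∞`.
  have hiff : ∀ g j : ℝ≥0∞, ENNReal.ofReal t < g * pathLoss α 0 x / j ↔
      ENNReal.ofReal (t * ‖x‖ ^ α) * j < g := fun g j => by
    rw [ENNReal.lt_div_iff_mul_lt (Or.inr (by simp)) (Or.inr (by simpa using ht)), hp,
      ← ENNReal.div_lt_iff (Or.inl (by simpa using hp0)) (Or.inl (by simp)), div_eq_mul_inv,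
      ← ENNReal.ofReal_inv_of_pos hp0, Real.rpow_neg hx'.le, inv_inv, ENNReal.ofReal_mul ht.le,
      mul_right_comm]
  simp_rw [hiff]
  rw [Measure.prod_apply_symm (measurableSet_lt (by fun_prop) (by fun_prop))]
  have hs : ∀ j, ν ((fun m => (m, j)) ⁻¹'
      {q : K × J | ENNReal.ofReal (t * ‖x‖ ^ α) * I q.2 < G q.1}) =
      expNeg (ENNReal.ofReal (t * ‖x‖ ^ α) * I j) := fun j => hG (ENNReal.ofReal (t * ‖x‖ ^ α) * I j)
  simp_rw [hs]
  rw [h _ (by positivity), Real.mul_rpow ht.le hpa.le, ← Real.rpow_mul hx'.le,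
    mul_div_cancel₀ _ hα.ne', Real.rpow_two, mul_assoc]

/-- The signal-to-interference ratio of a link with Rayleigh fading to the nearest receiver. -/
theorem IsHPPP.measure_lt_sir_nearest [IsProbabilityMeasure Q] (hQ : IsHPPP lam Q)
    (hlam : 0 < lam) {I : Plane → J → ℝ≥0∞} (h : ∀ y, HasInterfLaw α Λ (I y) ρ)
    (hI : Measurable (Function.uncurry I)) (hα : 0 < α) (hΛ : 0 < Λ)
    {K : Type} [MeasurableSpace K] {ν : Measure K} [IsProbabilityMeasure ν] {G : K → ℝ≥0∞}
    (hGm : Measurable G) (hG : IsUnitExp G ν) {t : ℝ} (ht : 0 < t) :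
    (Q.prod (ν.prod ρ)) {q | ENNReal.ofReal t <
        G q.2.1 * pathLoss α 0 (nearest q.1) / I (nearest q.1) q.2.2} =
      ENNReal.ofReal (Real.pi * lam / (Λ * t ^ (2 / α) + Real.pi * lam)) := by
  have hn := measurable_nearest
  have hI' : Measurable fun q : (ℕ → Plane) × K × J => I (nearest q.1) q.2.2 :=
    hI.comp (f := fun q : (ℕ → Plane) × K × J => (nearest q.1, q.2.2)) (by fun_prop)
  have hta : 0 < t ^ (2 / α) := Real.rpow_pos_of_pos ht _
  have hpl : 0 < Real.pi * lam := by positivity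
  rw [Measure.prod_apply (measurableSet_lt (by fun_prop) (by fun_prop))]
  -- The exponent is rewritten as a multiple of the unit exponential variable `π lam ‖nearest r‖²`,
  -- so that averaging is one more Laplace transform.
  have hs : ∀ᵐ r ∂Q, (ν.prod ρ) (Prod.mk r ⁻¹' {q : (ℕ → Plane) × K × J | ENNReal.ofReal t <
        G q.2.1 * pathLoss α 0 (nearest q.1) / I (nearest q.1) q.2.2}) =
      expNeg (ENNReal.ofReal (Λ * t ^ (2 / α) / (Real.pi * lam)) *
        ENNReal.ofReal (Real.pi * lam * ‖nearest r‖ ^ 2)) := by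
    filter_upwards [hQ.ae_nearest_ne_zero hlam] with r hr
    refine ((h (nearest r)).measure_lt_sir (by fun_prop) hα hGm hG hr ht).trans ?_
    rw [← ENNReal.ofReal_mul (by positivity)]
    congr 2
    field_simp
  rw [lintegral_congr_ae hs, (hQ.isUnitExp_nearest hlam).laplace (by fun_prop),
    ← ENNReal.ofReal_one, ← ENNReal.ofReal_add zero_le_one (by positivity),
    ← ENNReal.ofReal_inv_of_pos (by positivity)]
  congr 1
  field_simp
  ring

/-- The maximum of the ratios that the points of a marked Poisson point process see. -/
theorem IsHPPP.measure_iSup_le [IsProbabilityMeasure Q] (hQ : IsHPPP lam Q) (hlam : 0 < lam)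
    {K : Type} [MeasurableSpace K] {ν : Measure K} [IsProbabilityMeasure ν]
    {S : Plane → K → ℝ≥0∞} (hS : Measurable (Function.uncurry S)) {c : ℝ} (hc : 0 < c)
    {y : ℝ≥0∞} (h : ∀ x ≠ 0, ν {m | y < S x m} = expNeg (ENNReal.ofReal (c * ‖x‖ ^ 2))) :
    markedLaw Q ν {F | ⨆ k, S (F.1 k) (F.2 k) ≤ y} =
      ENNReal.ofReal (Real.exp (-(Real.pi * lam / c))) := by
  classical
  -- An infinite penalty for each point exceeding `y` makes `expNeg` of the total the indicator that
  -- no point does. The law of the maximum is thereby a Laplace functional.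
  let f : Plane → K → ℝ≥0∞ := fun x m => if y < S x m then ∞ else 0
  have hf : Measurable (Function.uncurry f) :=
    Measurable.ite (measurableSet_lt measurable_const hS) measurable_const measurable_const
  have hm : MeasurableSet {F : Marked K | ⨆ k, S (F.1 k) (F.2 k) ≤ y} :=
    measurableSet_le (Measurable.iSup fun k =>
      hS.comp (f := fun F : Marked K => (F.1 k, F.2 k)) (by fun_prop)) measurable_const
  set A : Set (Marked K) := {F : Marked K | ⨆ k, S (F.1 k) (F.2 k) ≤ y} with hA
  have h1 : ∀ F : Marked K, A.indicator 1 F =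
      expNeg (∑' i, f (F.1 i) (F.2 i)) := fun F => by
    by_cases hF : ⨆ k, S (F.1 k) (F.2 k) ≤ y
    · rw [indicator_of_mem (show F ∈ A from hF), ENNReal.tsum_eq_zero.2]
      · simp
      · intro k
        exact if_neg (not_lt.2 (iSup_le_iff.1 hF k))
    · rw [indicator_of_notMem (show F ∉ A from hF)]
      rw [iSup_le_iff] at hF
      push Not at hF
      obtain ⟨k, hk⟩ := hF
      rw [ENNReal.tsum_eq_top_of_eq_top ⟨k, if_pos hk⟩, expNeg_top]
  rw [← lintegral_indicator_one hm, lintegral_congr h1, hQ.laplace_marked ν hf]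
  have h2 : ∀ x, 1 - ∫⁻ m, expNeg (f x m) ∂ν = ν {m | y < S x m} := fun x => by
    have hms : MeasurableSet {m | y < S x m} := measurableSet_lt measurable_const (by fun_prop)
    have : ∀ m, expNeg (f x m) = {m | y < S x m}ᶜ.indicator 1 m := fun m => by
      by_cases hm : y < S x m <;> simp [f, hm]
    simp_rw [this]
    rw [lintegral_indicator_one hms.compl, ← prob_compl_eq_one_sub hms.compl, compl_compl]
  have h3 : ∀ᵐ x : Plane, 1 - ∫⁻ m, expNeg (f x m) ∂ν = expNeg (ENNReal.ofReal (c * ‖x‖ ^ 2)) := by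
    filter_upwards [Measure.ae_ne volume (0 : Plane)] with x hx
    rw [h2, h x hx]
  rw [lintegral_congr_ae h3, lintegral_expNeg_mul_norm_sq hc, ← ENNReal.ofReal_mul hlam.le,
    expNeg_ofReal (by positivity)]
  congr 3
  ring

end

section

/-! ### Laws of the ratios -/

/-- The cumulative distribution function of the ratio at the most detrimental eavesdropper. -/
noncomputable def eveCDF (b κ : ℝ) (y : ℝ) : ℝ := if y ≤ 0 then 0 else Real.exp (-(b / y ^ κ))

/-- The density of the ratio at the most detrimental eavesdropper. -/
noncomputable def evePDF (b κ : ℝ) (y : ℝ) : ℝ :=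
  b * κ / y ^ (κ + 1) * Real.exp (-(b / y ^ κ))

variable {a b κ : ℝ}

lemma evePDF_nonneg (hb : 0 < b) (hκ : 0 < κ) {y : ℝ} (hy : 0 < y) : 0 ≤ evePDF b κ y := by
  have h := Real.rpow_pos_of_pos hy (κ + 1)
  unfold evePDF
  positivity

@[fun_prop] lemma measurable_evePDF : Measurable (evePDF b κ) := by
  unfold evePDF
  fun_prop

lemma hasDerivAt_eveCDF {y : ℝ} (hy : 0 < y) : HasDerivAt (eveCDF b κ) (evePDF b κ y) y := by
  have hpos := Real.rpow_pos_of_pos hy κ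
  have h1 : HasDerivAt (fun y : ℝ => Real.exp (-(b * y ^ (-κ)))) (evePDF b κ y) y := by
    have h := (((Real.hasDerivAt_rpow_const (p := -κ) (Or.inl hy.ne')).const_mul b).fun_neg).exp
    have e : Real.exp (-(b * y ^ (-κ))) * -(b * (-κ * y ^ (-κ - 1))) = evePDF b κ y := by
      rw [evePDF, show -κ - 1 = -(κ + 1) by ring, Real.rpow_neg hy.le, Real.rpow_neg hy.le]
      ring_nf
    rwa [e] at h
  refine h1.congr_of_eventuallyEq ?_
  filter_upwards [lt_mem_nhds hy] with z hz
  rw [eveCDF, if_neg (not_le.2 hz), Real.rpow_neg hz.le, div_eq_mul_inv]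

lemma continuousWithinAt_eveCDF (hb : 0 < b) (hκ : 0 < κ) {y : ℝ} (hy : 0 ≤ y) :
    ContinuousWithinAt (eveCDF b κ) (Ici y) y := by
  rcases hy.eq_or_lt with rfl | hy
  · rw [continuousWithinAt_Ioi_iff_Ici.symm, ContinuousWithinAt]
    -- The separate case in `eveCDF` matters: with division by zero the formula would give `1` at
    -- the origin.
    have h0 : eveCDF b κ 0 = 0 := if_pos le_rfl
    rw [h0]
    have h1 : Tendsto (fun y : ℝ => Real.exp (-(b * (y ^ κ)⁻¹))) (𝓝[>] 0) (𝓝 0) := by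
      refine Real.tendsto_exp_neg_atTop_nhds_zero.comp (Tendsto.const_mul_atTop hb ?_)
      refine tendsto_inv_nhdsGT_zero.comp (tendsto_nhdsWithin_iff.2 ⟨?_, ?_⟩)
      · have : Tendsto (fun y : ℝ => y ^ κ) (𝓝 0) (𝓝 (0 ^ κ)) :=
          (Real.continuousAt_rpow_const 0 κ (Or.inr hκ.le)).tendsto
        rw [Real.zero_rpow hκ.ne'] at this
        exact this.mono_left nhdsWithin_le_nhds
      · filter_upwards [self_mem_nhdsWithin] with y hy using Real.rpow_pos_of_pos hy _
    refine h1.congr' ?_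
    filter_upwards [self_mem_nhdsWithin] with y hy
    rw [eveCDF, if_neg (not_le.2 hy), div_eq_mul_inv]
  · exact (hasDerivAt_eveCDF hy).continuousAt.continuousWithinAt

lemma tendsto_eveCDF_atTop (hκ : 0 < κ) : Tendsto (eveCDF b κ) atTop (𝓝 1) := by
  have h1 : Tendsto (fun y : ℝ => Real.exp (-(b * (y ^ κ)⁻¹))) atTop (𝓝 1) := by
    have h := ((tendsto_inv_atTop_zero.comp (tendsto_rpow_atTop hκ)).const_mul b).neg
    rw [mul_zero, neg_zero] at h
    simpa [Function.comp_def] using (Real.continuous_exp.tendsto 0).comp h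
  refine h1.congr' ?_
  filter_upwards [eventually_gt_atTop 0] with y hy
  rw [eveCDF, if_neg (not_le.2 hy), div_eq_mul_inv]

lemma lintegral_evePDF_Ioi (hb : 0 < b) (hκ : 0 < κ) {y : ℝ} (hy : 0 ≤ y) :
    ∫⁻ z in Ioi y, ENNReal.ofReal (evePDF b κ z) = ENNReal.ofReal (1 - eveCDF b κ y) := by
  have hd : ∀ z ∈ Ioi y, HasDerivAt (eveCDF b κ) (evePDF b κ z) z :=
    fun z hz => hasDerivAt_eveCDF (hy.trans_lt hz)
  have hp : ∀ z ∈ Ioi y, 0 ≤ evePDF b κ z := fun z hz => evePDF_nonneg hb hκ (hy.trans_lt hz)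
  have hc := continuousWithinAt_eveCDF hb hκ hy
  have ht := tendsto_eveCDF_atTop (b := b) hκ
  rw [← integral_Ioi_of_hasDerivAt_of_nonneg hc hd hp ht, ofReal_integral_eq_lintegral_ofReal
    (integrableOn_Ioi_deriv_of_nonneg hc hd hp ht)]
  exact (ae_restrict_iff' measurableSet_Ioi).2 (ae_of_all _ hp)

variable {Ω' : Type*} [MeasurableSpace Ω'] {ρ : Measure Ω'} {X Y : Ω' → ℝ≥0∞}

lemma ae_ne_top_of_tendsto_measure {F : ℕ → ℝ≥0∞} (hX : ∀ n : ℕ, ρ {ω | (n : ℝ≥0∞) + 1 < X ω} ≤ F n)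
    (hF : Tendsto F atTop (𝓝 0)) : ∀ᵐ ω ∂ρ, X ω ≠ ∞ := by
  rw [ae_iff]
  refine le_antisymm (ge_of_tendsto' hF fun n => (measure_mono fun ω hω => ?_).trans (hX n)) zero_le
  have hω : X ω = ∞ := by simpa using hω
  rw [mem_ofPred_eq, hω]
  exact ENNReal.add_lt_top.2 ⟨ENNReal.natCast_lt_top n, ENNReal.one_lt_top⟩

lemma tendsto_natCast_add_one : Tendsto (fun n : ℕ => (n : ℝ) + 1) atTop atTop :=
  tendsto_atTop_add_const_right _ _ tendsto_natCast_atTop_atTop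

lemma ofReal_natCast_add_one (n : ℕ) : ENNReal.ofReal ((n : ℝ) + 1) = (n : ℝ≥0∞) + 1 := by
  rw [ENNReal.ofReal_add (by positivity) zero_le_one]
  simp

/-- `capacity` reads an infinite ratio as `0` through `toReal`. Finiteness of the main ratio is
needed before the rate can be compared with a threshold. -/
lemma ae_ne_top_of_link (hκ : 0 < κ)
    (hX : ∀ t : ℝ, 0 < t → ρ {ω | ENNReal.ofReal t < X ω} = ENNReal.ofReal (a / (t ^ κ + a))) :
    ∀ᵐ ω ∂ρ, X ω ≠ ∞ := by
  refine ae_ne_top_of_tendsto_measure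
    (F := fun n : ℕ => ENNReal.ofReal (a / (((n : ℝ) + 1) ^ κ + a))) (fun n => ?_) ?_
  · rw [← hX _ (by positivity), ofReal_natCast_add_one]
  · rw [← ENNReal.ofReal_zero]
    refine ENNReal.tendsto_ofReal (Tendsto.const_div_atTop ?_ a)
    exact tendsto_atTop_add_const_right _ _
      ((tendsto_rpow_atTop hκ).comp tendsto_natCast_add_one)

/-! ### Secrecy outage -/

/-- The positive part of the difference of the capacities of the main link and of the
eavesdroppers. -/
noncomputable def secrecyRate (γ γ' : ℝ≥0∞) : ℝ := max (capacity γ - capacity γ') 0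

@[fun_prop] lemma measurable_secrecyRate {Ω : Type*} [MeasurableSpace Ω] {X Y : Ω → ℝ≥0∞}
    (hX : Measurable X) (hY : Measurable Y) : Measurable fun ω => secrecyRate (X ω) (Y ω) := by
  unfold secrecyRate capacity Real.logb
  fun_prop

lemma one_lt_two_rpow_mul {x y : ℝ} (hx : 0 < x) (hy : 0 ≤ y) : 1 < 2 ^ x * (1 + y) := by
  have h := Real.one_lt_rpow one_lt_two hx
  nlinarith

/-- Exponentiating the difference of logarithms gives the threshold. Only `γ` must be finite, since
`γ'` enters both sides through the same `toReal`. -/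
lemma lt_secrecyRate_iff {x : ℝ} (hx : 0 < x) {γ γ' : ℝ≥0∞} (hγ : γ ≠ ∞) :
    x < secrecyRate γ γ' ↔ ENNReal.ofReal (2 ^ x * (1 + γ'.toReal) - 1) < γ := by
  have h1 : 0 < 1 + γ.toReal := by positivity
  have h2 : 0 < 1 + γ'.toReal := by positivity
  have h3 := one_lt_two_rpow_mul hx (y := γ'.toReal) ENNReal.toReal_nonneg
  rw [secrecyRate, lt_max_iff, or_iff_left (not_lt.2 hx.le), capacity, capacity, lt_sub_iff_add_lt,
    ENNReal.ofReal_lt_iff_lt_toReal (by linarith) hγ, sub_lt_iff_lt_add']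
  have h4 : x + Real.logb 2 (1 + γ'.toReal) = Real.logb 2 (2 ^ x * (1 + γ'.toReal)) := by
    rw [Real.logb_mul (by positivity) h2.ne', Real.logb_rpow two_pos (by norm_num)]
  rw [h4, Real.logb_lt_logb_iff one_lt_two (by linarith) h1]

/-- Discarding the eavesdroppers lowers the threshold to `2^x - 1`, which is at least `2^x / 2` for
`x > 1`. The link tail at `t` is at most `a t^(-κ)`, hence the exponential decay. -/
theorem measure_lt_secrecyRate_le (ha : 0 < a) (hκ : 0 < κ)
    (hX : ∀ t : ℝ, 0 < t → ρ {ω | ENNReal.ofReal t < X ω} = ENNReal.ofReal (a / (t ^ κ + a)))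
    {x : ℝ} (hx : 1 < x) :
    ρ {ω | x < secrecyRate (X ω) (Y ω)} ≤
      ENNReal.ofReal (a * 2 ^ κ * Real.exp (-(κ * Real.log 2 * x))) := by
  have hx0 : 0 < x := by linarith
  have h2x : (2 : ℝ) ≤ 2 ^ x := by
    simpa using Real.rpow_le_rpow_of_exponent_le one_le_two hx.le
  have ht : 0 < (2 : ℝ) ^ x / 2 := by positivity
  have hle : ρ {ω | x < secrecyRate (X ω) (Y ω)} ≤ ρ {ω | ENNReal.ofReal (2 ^ x / 2) < X ω} := by
    refine measure_mono_ae ?_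
    filter_upwards [ae_ne_top_of_link hκ hX] with ω hω h
    refine lt_of_le_of_lt (ENNReal.ofReal_le_ofReal ?_) ((lt_secrecyRate_iff hx0 hω).1 h)
    have : 0 ≤ (2 : ℝ) ^ x * (Y ω).toReal := by positivity
    linarith
  refine hle.trans ?_
  rw [hX _ ht]
  refine ENNReal.ofReal_le_ofReal ?_
  have htκ := Real.rpow_pos_of_pos ht κ
  have e : a * 2 ^ κ * Real.exp (-(κ * Real.log 2 * x)) = a / (2 ^ x / 2) ^ κ := by
    rw [Real.div_rpow (by positivity) (by positivity), ← Real.rpow_mul zero_le_two,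
      Real.rpow_def_of_pos two_pos (x * κ), Real.exp_neg]
    field_simp
  rw [e]
  gcongr
  linarith

/-! ### The law of the most detrimental ratio and the secrecy rate -/

variable [IsProbabilityMeasure ρ]

lemma measure_lt_eve (hYm : Measurable Y)
    (hY : ∀ y : ℝ, 0 < y →
      ρ {ω | Y ω ≤ ENNReal.ofReal y} = ENNReal.ofReal (Real.exp (-(b / y ^ κ))))
    {y : ℝ} (hy : 0 < y) :
    ρ {ω | ENNReal.ofReal y < Y ω} = ENNReal.ofReal (1 - eveCDF b κ y) := by
  have h := prob_compl_eq_one_sub (μ := ρ) (measurableSet_le hYm (measurable_const (a := ENNReal.ofReal y)))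
  rw [hY y hy] at h
  rw [eveCDF, if_neg (not_le.2 hy), ENNReal.ofReal_sub _ (Real.exp_pos _).le, ENNReal.ofReal_one, ← h]
  congr 1
  ext ω
  simp

lemma ae_ne_top_of_eve (hYm : Measurable Y) (hκ : 0 < κ)
    (hY : ∀ y : ℝ, 0 < y →
      ρ {ω | Y ω ≤ ENNReal.ofReal y} = ENNReal.ofReal (Real.exp (-(b / y ^ κ)))) :
    ∀ᵐ ω ∂ρ, Y ω ≠ ∞ := by
  refine ae_ne_top_of_tendsto_measure
    (F := fun n : ℕ => ENNReal.ofReal (1 - eveCDF b κ ((n : ℝ) + 1))) (fun n => ?_) ?_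
  · rw [← measure_lt_eve hYm hY (by positivity), ofReal_natCast_add_one]
  · rw [← ENNReal.ofReal_zero, ← sub_self (1 : ℝ)]
    exact ENNReal.tendsto_ofReal
      (((tendsto_eveCDF_atTop hκ).comp tendsto_natCast_add_one).const_sub 1)

lemma map_eve (hYm : Measurable Y) (hb : 0 < b) (hκ : 0 < κ)
    (hY : ∀ y : ℝ, 0 < y →
      ρ {ω | Y ω ≤ ENNReal.ofReal y} = ENNReal.ofReal (Real.exp (-(b / y ^ κ)))) :
    ρ.map (fun ω => (Y ω).toReal) =
    (volume.restrict (Ioi 0)).withDensity fun y => ENNReal.ofReal (evePDF b κ y) := by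
  have hfin := ae_ne_top_of_eve hYm hκ hY
  have htop : ∀ y : ℝ, 0 < y → ρ {ω | y < (Y ω).toReal} = ENNReal.ofReal (1 - eveCDF b κ y) := by
    intro y hy
    rw [← measure_lt_eve hYm hY hy]
    refine measure_congr ?_
    filter_upwards [hfin] with ω hω
    exact propext (ENNReal.ofReal_lt_iff_lt_toReal hy.le hω).symm
  have hD : ∀ y : ℝ, ((volume.restrict (Ioi 0)).withDensity fun y => ENNReal.ofReal (evePDF b κ y))
      (Ioi y) = ENNReal.ofReal (1 - eveCDF b κ (max y 0)) := fun y => by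
    rw [withDensity_apply _ measurableSet_Ioi, Measure.restrict_restrict measurableSet_Ioi,
      Ioi_inter_Ioi]
    exact lintegral_evePDF_Ioi hb hκ (le_max_right _ _)
  have h0 : eveCDF b κ 0 = 0 := if_pos le_rfl
  have : IsProbabilityMeasure (ρ.map (fun ω => (Y ω).toReal)) :=
    Measure.isProbabilityMeasure_map (by fun_prop)
  have : IsProbabilityMeasure
      ((volume.restrict (Ioi 0)).withDensity fun y => ENNReal.ofReal (evePDF b κ y)) := by
    constructor
    rw [withDensity_apply _ MeasurableSet.univ, Measure.restrict_univ,
      lintegral_evePDF_Ioi hb hκ le_rfl, h0]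
    simp
  refine ext_of_Ioi _ _ fun y => ?_
  rw [hD, Measure.map_apply (by fun_prop) measurableSet_Ioi]
  change ρ {ω | y < (Y ω).toReal} = _
  rcases lt_or_ge 0 y with hy | hy
  · rw [htop y hy, max_eq_left hy.le]
  -- For `y ≤ 0` the full mass must be recovered from positive levels: the tails at `z > 0` tend to
  -- one as `z` decreases to `0`, so there is no atom at zero.
  · rw [max_eq_right hy, h0, sub_zero, ENNReal.ofReal_one]
    refine le_antisymm prob_le_one ?_
    have ht : Tendsto (fun z => ENNReal.ofReal (1 - eveCDF b κ z)) (𝓝[>] 0) (𝓝 1) := by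
      have h := continuousWithinAt_Ioi_iff_Ici.2 (continuousWithinAt_eveCDF hb hκ (le_refl 0))
      rw [ContinuousWithinAt, h0] at h
      simpa using ENNReal.tendsto_ofReal (h.const_sub 1)
    refine le_of_tendsto ht ?_
    filter_upwards [self_mem_nhdsWithin] with z hz
    rw [← htop z hz]
    exact measure_mono fun ω (hω : z < _) => hy.trans_lt (lt_trans hz hω)

/-- Conditioning on the eavesdroppers' ratio: by independence, the main link's tail is evaluated at
the random threshold and integrated against `evePDF`. -/
theorem measure_lt_secrecyRate (hXm : Measurable X) (hYm : Measurable Y) (hXY : IndepFun X Y ρ)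
    (ha : 0 < a) (hb : 0 < b) (hκ : 0 < κ)
    (hX : ∀ t : ℝ, 0 < t → ρ {ω | ENNReal.ofReal t < X ω} = ENNReal.ofReal (a / (t ^ κ + a)))
    (hY : ∀ y : ℝ, 0 < y →
      ρ {ω | Y ω ≤ ENNReal.ofReal y} = ENNReal.ofReal (Real.exp (-(b / y ^ κ))))
    {x : ℝ} (hx : 0 < x) :
    (ρ {ω | x < secrecyRate (X ω) (Y ω)}).toReal =
      ∫ y in Ioi (0 : ℝ), evePDF b κ y * (a / ((2 ^ x * (1 + y) - 1) ^ κ + a)) := by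
  have e1 : ρ {ω | x < secrecyRate (X ω) (Y ω)} =
      ρ {ω | ENNReal.ofReal (2 ^ x * (1 + (Y ω).toReal) - 1) < X ω} := by
    refine measure_congr ?_
    filter_upwards [ae_ne_top_of_link hκ hX] with ω hω
    exact propext (lt_secrecyRate_iff hx hω)
  have hXY' : IndepFun X (fun ω => (Y ω).toReal) ρ :=
    hXY.comp measurable_id ENNReal.measurable_toReal
  have e2 := (indepFun_iff_map_prod_eq_prod_map_map hXm.aemeasurable (by fun_prop)).1 hXY'
  have hms : MeasurableSet {p : ℝ≥0∞ × ℝ | ENNReal.ofReal (2 ^ x * (1 + p.2) - 1) < p.1} :=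
    measurableSet_lt (by fun_prop) (by fun_prop)
  have e3 : ρ {ω | ENNReal.ofReal (2 ^ x * (1 + (Y ω).toReal) - 1) < X ω} =
      ρ.map (fun ω => (X ω, (Y ω).toReal))
        {p : ℝ≥0∞ × ℝ | ENNReal.ofReal (2 ^ x * (1 + p.2) - 1) < p.1} := by
    rw [Measure.map_apply (by fun_prop) hms]
    rfl
  have hpos : ∀ y ∈ Ioi (0 : ℝ), 0 < 2 ^ x * (1 + y) - 1 := fun y hy => by
    linarith [one_lt_two_rpow_mul hx (le_of_lt hy)]
  rw [e1, e3, e2, map_eve hYm hb hκ hY, Measure.prod_apply_symm hms,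
    lintegral_withDensity_eq_lintegral_mul _ (by fun_prop) (measurable_measure_prodMk_right hms),
    setLIntegral_congr_fun (g := fun y =>
      ENNReal.ofReal (evePDF b κ y * (a / ((2 ^ x * (1 + y) - 1) ^ κ + a)))) measurableSet_Ioi
      fun y hy => ?_]
  · rw [integral_eq_lintegral_of_nonneg_ae]
    · refine (ae_restrict_iff' measurableSet_Ioi).2 (ae_of_all _ fun y hy => ?_)
      have h1 := evePDF_nonneg hb hκ hy
      have h2 := Real.rpow_pos_of_pos (hpos y hy) κ
      simp only [Pi.zero_apply]
      positivity
    · exact Measurable.aestronglyMeasurable (by fun_prop)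
  · simp only [Pi.mul_apply]
    rw [ENNReal.ofReal_mul (evePDF_nonneg hb hκ hy), ← hX _ (hpos y hy),
      Measure.map_apply hXm (hms.preimage (by fun_prop))]
    rfl

end

section

/-! ### Measurability of the model -/

@[fun_prop] lemma measurable_energy {M : ℕ} : Measurable (energy : (Fin M → ℂ) → ℝ) := by
  unfold energy
  fun_prop

@[fun_prop] lemma measurable_beam {M : ℕ} : Measurable (beam : (Fin M → ℂ) → Fin M → ℂ) := by
  unfold beam
  exact measurable_pi_lambda _ fun a => by fun_prop

@[fun_prop] lemma Measurable.nearest {Ω : Type*} [MeasurableSpace Ω] {f : Ω → ℕ → Plane}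
    (hf : Measurable f) : Measurable fun ω => nearest (f ω) := measurable_nearest.comp hf

section

variable {Ω : Type*} [MeasurableSpace Ω] {M : ℕ} {α : ℝ}

@[fun_prop] lemma Measurable.sensorInterf {y : Ω → Plane} {F : Ω → Marked ℂ}
    (hy : Measurable y) (hF : Measurable F) : Measurable fun ω => sensorInterf α (y ω) (F ω) := by
  unfold WSN.sensorInterf
  exact Measurable.tsum fun i => by fun_prop

@[fun_prop] lemma Measurable.sensorInterfMRC {u : Ω → Fin M → ℂ} {y : Ω → Plane}
    {F : Ω → Marked (Fin M → ℂ)} (hu : Measurable u) (hy : Measurable y) (hF : Measurable F) :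
    Measurable fun ω => sensorInterfMRC α (u ω) (y ω) (F ω) := by
  unfold WSN.sensorInterfMRC
  exact Measurable.tsum fun i => by fun_prop

@[fun_prop] lemma Measurable.apInterf {y : Ω → Plane}
    {F : Ω → Marked ((Fin M → ℂ) × (Fin M → ℂ))} (hy : Measurable y) (hF : Measurable F) :
    Measurable fun ω => apInterf α (y ω) (F ω) := by
  unfold WSN.apInterf
  exact Measurable.tsum fun i => by fun_prop

@[fun_prop] lemma Measurable.apInterfMRC {u : Ω → Fin M → ℂ} {y : Ω → Plane}
    {F : Ω → Marked ((Fin M → Fin M → ℂ) × (Fin M → ℂ))} (hu : Measurable u) (hy : Measurable y)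
    (hF : Measurable F) : Measurable fun ω => apInterfMRC α (u ω) (y ω) (F ω) := by
  unfold WSN.apInterfMRC
  exact Measurable.tsum fun i => by fun_prop

variable {μ N : ℝ}

@[fun_prop] lemma measurable_sinrAP : Measurable (sinrAP α μ N : Hop₁ M → ℝ≥0∞) := by
  unfold sinrAP
  fun_prop

@[fun_prop] lemma measurable_sinrSE : Measurable (sinrSE α μ N : Hop₁ M → ℝ≥0∞) := by
  unfold sinrSE
  exact Measurable.iSup fun k => by fun_prop

@[fun_prop] lemma measurable_sinrSK : Measurable (sinrSK α N : Hop₂ M → ℝ≥0∞) := by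
  unfold sinrSK
  fun_prop

@[fun_prop] lemma measurable_sinrAPE : Measurable (sinrAPE α N : Hop₂ M → ℝ≥0∞) := by
  unfold sinrAPE
  exact Measurable.iSup fun k => by fun_prop

lemma measurable_secrecyAP : Measurable (secrecyAP α μ N : Hop₁ M → ℝ) :=
  measurable_secrecyRate (measurable_sinrAP (α := α) (μ := μ) (N := N)) measurable_sinrSE

lemma measurable_secrecySK : Measurable (secrecySK α N : Hop₂ M → ℝ) :=
  measurable_secrecyRate (measurable_sinrSK (α := α) (N := N)) measurable_sinrAPE

end

/-! ### Expectation of the minimum of independent rates -/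

lemma lintegral_ofReal_min {Ω : Type*} [MeasurableSpace Ω] {P : Measure Ω} {U V : Ω → ℝ}
    (hU : AEMeasurable U P) (hV : AEMeasurable V P) (hU0 : ∀ ω, 0 ≤ U ω) (hV0 : ∀ ω, 0 ≤ V ω)
    (hUV : IndepFun U V P) :
    ∫⁻ ω, ENNReal.ofReal (min (U ω) (V ω)) ∂P =
      ∫⁻ x in Ioi (0 : ℝ), P {ω | x < U ω} * P {ω | x < V ω} := by
  rw [lintegral_eq_lintegral_meas_lt P (ae_of_all _ fun ω => le_min (hU0 ω) (hV0 ω))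
    (hU.min hV)]
  refine lintegral_congr fun x => ?_
  refine Eq.trans ?_
    (hUV.measure_inter_preimage_eq_mul (Ioi x) (Ioi x) measurableSet_Ioi measurableSet_Ioi)
  congr 1
  ext ω
  simp

/-! ### Independence of the components of a product -/

/-- Adjoins a fresh independent coordinate to one member of an independent pair, by reassociating
the product measure. Iteration separates the eavesdroppers from all other coordinates of a nested
product. -/
lemma indepFun_prod_snd {A B C D : Type*} [MeasurableSpace A] [MeasurableSpace B]
    [MeasurableSpace C] [MeasurableSpace D] (μ : Measure A) [IsProbabilityMeasure μ]
    {ν : Measure B} [IsProbabilityMeasure ν] {g : B → C} {g' : B → D} (hg : Measurable g)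
    (hg' : Measurable g') (h : IndepFun g g' ν) :
    IndepFun (fun p : A × B => (p.1, g p.2)) (fun p : A × B => g' p.2) (μ.prod ν) := by
  have := Measure.isProbabilityMeasure_map (μ := ν) hg.aemeasurable
  have := Measure.isProbabilityMeasure_map (μ := ν) hg'.aemeasurable
  rw [indepFun_iff_map_prod_eq_prod_map_map (by fun_prop) (by fun_prop)] at h ⊢
  have e1 : (μ.prod ν).map (fun p : A × B => (p.1, g p.2)) = μ.prod (ν.map g) := by
    conv_rhs => rw [← Measure.map_id (μ := μ)]
    rw [Measure.map_prod_map _ _ measurable_id hg]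
    rfl
  have e2 : (μ.prod ν).map (fun p : A × B => g' p.2) = ν.map g' := by
    rw [show (fun p : A × B => g' p.2) = g' ∘ Prod.snd from rfl, ← Measure.map_map hg' measurable_snd,
      Measure.map_snd_prod]
    simp
  rw [e1, e2, ← (measurePreserving_prodAssoc μ (ν.map g) (ν.map g')).symm.map_eq, ← h,
    ← Measure.map_id (μ := μ), Measure.map_prod_map _ _ measurable_id (hg.prodMk hg'),
    Measure.map_id, Measure.map_map (by fun_prop) (by fun_prop)]
  rfl

/-! ### Single-antenna gains -/

/-- With one antenna the beamformer is a phase. The zero channel is excluded because there division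
by zero makes the beamformer vanish. -/
lemma gain_beam {w : Fin 1 → ℂ} (hw : w 0 ≠ 0) : gain (beam w 0) = 1 := by
  have h : 0 < ‖w 0‖ := norm_pos_iff.2 hw
  simp [gain, beam, energy, Real.sqrt_sq, h.ne', h.le]

lemma ofReal_energy (h : Fin 1 → ℂ) : ENNReal.ofReal (energy h) = gain (h 0) := by
  simp [energy, gain]

/-- The gain of the interference from an access point. -/
noncomputable def apGain (m : (Fin 1 → ℂ) × (Fin 1 → ℂ)) : ℝ≥0∞ := gain (∑ b, m.1 b * beam m.2 b)

@[fun_prop] lemma measurable_apGain : Measurable apGain := by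
  unfold apGain
  fun_prop

lemma isUnitExp_gain_rayleighVec : IsUnitExp (fun h : Fin 1 → ℂ => gain (h 0)) (rayleighVec 1) :=
  isUnitExp_gain.comp measurable_gain (measurePreserving_eval_rayleighVec 0)

lemma isUnitExp_apGain : IsUnitExp apGain ((rayleighVec 1).prod (rayleighVec 1)) := by
  refine (isUnitExp_gain_rayleighVec.comp (by fun_prop) measurePreserving_fst).congr ?_
  filter_upwards [Measure.quasiMeasurePreserving_snd.ae (ae_ne_zero_rayleighVec (M := 1) 0)] with m hm
  simp [apGain, gain_mul, gain_beam hm]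

lemma isUnitExp_apGain_row :
    IsUnitExp (fun m : (Fin 1 → Fin 1 → ℂ) × (Fin 1 → ℂ) => apGain (m.1 0, m.2))
      ((rayleighMat 1).prod (rayleighVec 1)) :=
  isUnitExp_apGain.comp measurable_apGain
    ((measurePreserving_eval_rayleighMat 0).prod (MeasurePreserving.id _))

end

section

/-! ### The first hop with a single antenna and without noise -/

lemma Lam₁_eq (lams ρs lamap ρap μ α : ℝ) :
    Lam₁ lams ρs lamap ρap μ α =
      lams * ρs * interfConst α + lamap * ρap * interfConst α * μ ^ (2 / α) := by
  unfold Lam₁ interfConst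
  ring

lemma Lam₂_eq (lamap ρap β : ℝ) : Lam₂ lamap ρap β = lamap * ρap * interfConst β := by
  unfold Lam₂ interfConst
  ring

variable {ls la lr lk le α β μ : ℝ} {Qs Qa Qr Qk Qe : Measure (ℕ → Plane)}

lemma ae_hopLaw₁_ne_zero : ∀ᵐ d ∂hopLaw₁ 1 Qr Qs Qa Qe, d.2.1 0 ≠ 0 := by
  unfold hopLaw₁
  exact (Measure.quasiMeasurePreserving_fst.comp Measure.quasiMeasurePreserving_snd).ae
    (ae_ne_zero_rayleighVec (M := 1) 0)

lemma ae_hopLaw₂_ne_zero : ∀ᵐ d ∂hopLaw₂ 1 Qk Qa Qe, d.2.1 0 ≠ 0 := by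
  unfold hopLaw₂
  exact (Measure.quasiMeasurePreserving_fst.comp Measure.quasiMeasurePreserving_snd).ae
    (ae_ne_zero_rayleighVec (M := 1) 0)

variable [IsProbabilityMeasure Qs] [IsProbabilityMeasure Qa] [IsProbabilityMeasure Qr]
  [IsProbabilityMeasure Qk] [IsProbabilityMeasure Qe]

/-- The interference at the typical access point, located at `y`. -/
noncomputable def interf₁ (α μ : ℝ) (y : Plane)
    (q : Marked (Fin 1 → ℂ) × Marked ((Fin 1 → Fin 1 → ℂ) × (Fin 1 → ℂ)) × Marked (EveMark₁ 1)) :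
    ℝ≥0∞ :=
  (∑' i, gain (q.1.2 i 0) * pathLoss α (q.1.1 i) y) +
    ENNReal.ofReal μ * ∑' j, apGain ((q.2.1.2 j).1 0, (q.2.1.2 j).2) * pathLoss α (q.2.1.1 j) y

lemma measurable_interf₁ : Measurable (Function.uncurry (interf₁ α μ)) := by
  unfold interf₁ Function.uncurry
  refine Measurable.add (Measurable.tsum fun i => by fun_prop)
    (Measurable.const_mul (Measurable.tsum fun i => by fun_prop) _)

lemma sinrAP_eq {d : Hop₁ 1} (hd : d.2.1 0 ≠ 0) :
    sinrAP α μ 0 d = gain (d.2.1 0) * pathLoss α 0 (nearest d.1) / interf₁ α μ (nearest d.1) d.2.2 := by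
  obtain ⟨r, h, S, A, E⟩ := d
  simp [sinrAP, interf₁, sensorInterfMRC, apInterfMRC, ofReal_energy, gain_mul, gain_beam hd, apGain]

lemma hasInterfLaw₁ (hQs : IsHPPP ls Qs) (hQa : IsHPPP la Qa) (hls : 0 < ls) (hla : 0 < la)
    (hα : 2 < α) (hμ : 0 < μ) {ρ : Measure (Marked (EveMark₁ 1))} [IsProbabilityMeasure ρ]
    (y : Plane) :
    HasInterfLaw α (ls * interfConst α + la * interfConst α * μ ^ (2 / α)) (interf₁ α μ y)
      ((markedLaw Qs (rayleighVec 1)).prod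
        ((markedLaw Qa ((rayleighMat 1).prod (rayleighVec 1))).prod ρ)) := by
  have hc := interfConst_pos hα
  have h1 := hQs.hasInterfLaw hls (by fun_prop) isUnitExp_gain_rayleighVec hα y
  have h2 := hQa.hasInterfLaw hla (by fun_prop) isUnitExp_apGain_row hα y
  exact h1.add (h2.fst (ρ' := ρ) (Measurable.tsum fun i => by fun_prop))
    (Measurable.tsum fun i => by fun_prop) (Measurable.tsum fun i => by fun_prop)
    (by positivity) (by positivity) hμ

/-- Dividing through by `Λ` brings both hops to the form `a / (t^κ + a)` used for secrecy outage. -/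
lemma ofReal_div_normalize {a Λ s : ℝ} (hΛ : 0 < Λ) :
    ENNReal.ofReal (a / (Λ * s + a)) = ENNReal.ofReal (a / Λ / (s + a / Λ)) := by
  congr 1
  rw [div_div, mul_add, mul_div_cancel₀ _ hΛ.ne']

theorem measure_lt_sinrAP (hQs : IsHPPP ls Qs) (hQa : IsHPPP la Qa) (hQr : IsHPPP lr Qr)
    (hls : 0 < ls) (hla : 0 < la) (hlr : 0 < lr) (hα : 2 < α) (hμ : 0 < μ) {Λ : ℝ}
    (hΛ : Λ = ls * interfConst α + la * interfConst α * μ ^ (2 / α)) {t : ℝ} (ht : 0 < t) :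
    hopLaw₁ 1 Qr Qs Qa Qe {d | ENNReal.ofReal t < sinrAP α μ 0 d} =
      ENNReal.ofReal (Real.pi * lr / Λ / (t ^ (2 / α) + Real.pi * lr / Λ)) := by
  have hc := interfConst_pos hα
  have hΛ0 : 0 < Λ := by rw [hΛ]; positivity
  rw [← ofReal_div_normalize hΛ0, ← hQr.measure_lt_sir_nearest hlr (I := interf₁ α μ)
    (fun y => hΛ ▸ hasInterfLaw₁ (ρ := markedLaw Qe (rayleigh.prod
      ((markedLaw Qs rayleigh).prod (markedLaw Qa ((rayleighVec 1).prod (rayleighVec 1)))))) hQs hQa hls hla hα hμ y) measurable_interf₁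
    (by linarith) hΛ0 (by fun_prop) isUnitExp_gain_rayleighVec ht]
  refine measure_congr ?_
  filter_upwards [ae_hopLaw₁_ne_zero] with d hd
  refine propext ?_
  change ENNReal.ofReal t < sinrAP α μ 0 d ↔ ENNReal.ofReal t < _
  rw [sinrAP_eq hd]

theorem measure_sinrSE_le (hQs : IsHPPP ls Qs) (hQa : IsHPPP la Qa) (hQe : IsHPPP le Qe)
    (hls : 0 < ls) (hla : 0 < la) (hle : 0 < le) (hα : 2 < α) (hμ : 0 < μ) {Λ : ℝ}
    (hΛ : Λ = ls * interfConst α + la * interfConst α * μ ^ (2 / α)) {y : ℝ} (hy : 0 < y) :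
    hopLaw₁ 1 Qr Qs Qa Qe {d | sinrSE α μ 0 d ≤ ENNReal.ofReal y} =
      ENNReal.ofReal (Real.exp (-(Real.pi * le / Λ / y ^ (2 / α)))) := by
  have hc := interfConst_pos hα
  have hΛ0 : 0 < Λ := by rw [hΛ]; positivity
  have hyα := Real.rpow_pos_of_pos hy (2 / α)
  let S : Plane → EveMark₁ 1 → ℝ≥0∞ := fun x m => gain m.1 * pathLoss α 0 x /
    (sensorInterf α x m.2.1 + ENNReal.ofReal μ * apInterf α x m.2.2 + ENNReal.ofReal 0)
  have hS : Measurable (Function.uncurry S) := by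
    unfold S Function.uncurry
    fun_prop
  let T : Set (Marked (EveMark₁ 1)) := {F | ⨆ k, S (F.1 k) (F.2 k) ≤ ENNReal.ofReal y}
  have hT : MeasurableSet T := measurableSet_le (Measurable.iSup fun k =>
    hS.comp (f := fun F : Marked (EveMark₁ 1) => (F.1 k, F.2 k)) (by fun_prop)) measurable_const
  have hmp : MeasurePreserving (fun d : Hop₁ 1 => d.2.2.2.2) (hopLaw₁ 1 Qr Qs Qa Qe)
      (markedLaw Qe (rayleigh.prod ((markedLaw Qs rayleigh).prod
        (markedLaw Qa ((rayleighVec 1).prod (rayleighVec 1)))))) :=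
    measurePreserving_snd.comp (measurePreserving_snd.comp
      (measurePreserving_snd.comp measurePreserving_snd))
  have h1 := hmp.measure_preimage hT.nullMeasurableSet
  refine Eq.trans h1 ?_
  have h2 := hQe.measure_iSup_le hle (ν := rayleigh.prod ((markedLaw Qs rayleigh).prod
        (markedLaw Qa ((rayleighVec 1).prod (rayleighVec 1))))) hS
        (c := Λ * y ^ (2 / α)) (by positivity) (y := ENNReal.ofReal y) fun x hx => ?_
  · rw [div_div]
    exact h2
  -- Each eavesdropper carries its own copies of both fields in its mark, so at a fixed location `x`
  -- it is a single Rayleigh link.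
  · have hI := (hQs.hasInterfLaw hls measurable_gain isUnitExp_gain hα x).add
      (hQa.hasInterfLaw hla measurable_apGain isUnitExp_apGain hα x)
      (Measurable.tsum fun i => by fun_prop) (Measurable.tsum fun i => by fun_prop)
      (by positivity) (by positivity) hμ
    rw [← hΛ] at hI
    refine Eq.trans ?_ (hI.measure_lt_sir (Measurable.add (Measurable.tsum fun i => by fun_prop)
      (Measurable.const_mul (Measurable.tsum fun i => by fun_prop) _)) (by linarith) measurable_gain
      isUnitExp_gain hx hy)
    simp only [S, ENNReal.ofReal_zero, add_zero]
    rfl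

lemma indepFun_sinrAP_sinrSE :
    IndepFun (sinrAP α μ 0) (sinrSE α μ 0) (hopLaw₁ 1 Qr Qs Qa Qe) := by
  have h4 := indepFun_prod (μ := markedLaw Qa ((rayleighMat 1).prod (rayleighVec 1)))
    (ν := markedLaw Qe (rayleigh.prod ((markedLaw Qs rayleigh).prod
        (markedLaw Qa ((rayleighVec 1).prod (rayleighVec 1)))))) measurable_id measurable_id
  have h3 := indepFun_prod_snd (markedLaw Qs (rayleighVec 1)) (by fun_prop) (by fun_prop) h4
  have h2 := indepFun_prod_snd (rayleighVec 1) (by fun_prop) (by fun_prop) h3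
  have h1 := indepFun_prod_snd Qr (by fun_prop) (by fun_prop) h2
  let f : (ℕ → Plane) × (Fin 1 → ℂ) × Marked (Fin 1 → ℂ) ×
      Marked ((Fin 1 → Fin 1 → ℂ) × (Fin 1 → ℂ)) → ℝ≥0∞ := fun p =>
    ENNReal.ofReal (energy p.2.1) * pathLoss α 0 (nearest p.1) /
      (sensorInterfMRC α (beam p.2.1) (nearest p.1) p.2.2.1 +
        ENNReal.ofReal μ * apInterfMRC α (beam p.2.1) (nearest p.1) p.2.2.2 + ENNReal.ofReal 0)
  let g : Marked (EveMark₁ 1) → ℝ≥0∞ := fun E => ⨆ k, gain (E.2 k).1 * pathLoss α 0 (E.1 k) /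
      (sensorInterf α (E.1 k) (E.2 k).2.1 +
        ENNReal.ofReal μ * apInterf α (E.1 k) (E.2 k).2.2 + ENNReal.ofReal 0)
  have hf : Measurable f := by unfold f; fun_prop
  have hg : Measurable g := Measurable.iSup fun k => by fun_prop
  exact h1.comp hf hg

/-! ### The second hop with a single antenna and without noise -/

lemma sinrSK_eq (d : Hop₂ 1) :
    sinrSK β 0 d = gain (d.2.1 0) * pathLoss β 0 (nearest d.1) / apInterf β (nearest d.1) d.2.2.1 := by
  obtain ⟨s, g, A, E⟩ := d
  simp [sinrSK, ofReal_energy]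

/-- The ratio at an eavesdropper of the second hop at `x`, when access points have one antenna. -/
noncomputable def eveSIR₂ (β : ℝ) (x : Plane) (m : EveMark₂ 1) : ℝ≥0∞ :=
  gain (m.1 0) * pathLoss β 0 x / apInterf β x m.2

lemma measurable_eveSIR₂ : Measurable (Function.uncurry (eveSIR₂ β)) := by
  unfold eveSIR₂ Function.uncurry
  fun_prop

lemma measurable_iSup_eveSIR₂ :
    Measurable fun F : Marked (EveMark₂ 1) => ⨆ k, eveSIR₂ β (F.1 k) (F.2 k) :=
  Measurable.iSup fun k => measurable_eveSIR₂.comp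
    (f := fun F : Marked (EveMark₂ 1) => (F.1 k, F.2 k)) (by fun_prop)

lemma sinrAPE_eq {d : Hop₂ 1} (hd : d.2.1 0 ≠ 0) :
    sinrAPE β 0 d = ⨆ k, eveSIR₂ β (d.2.2.2.1 k) (d.2.2.2.2 k) := by
  obtain ⟨s, g, A, E⟩ := d
  simp [sinrAPE, eveSIR₂, gain_mul, gain_beam hd]

lemma hasInterfLaw_apInterf (hQa : IsHPPP la Qa) (hla : 0 < la) (hβ : 2 < β) (y : Plane) :
    HasInterfLaw β (la * interfConst β) (apInterf β y)
      (markedLaw Qa ((rayleighVec 1).prod (rayleighVec 1))) :=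
  hQa.hasInterfLaw hla measurable_apGain isUnitExp_apGain hβ y

theorem measure_lt_sinrSK (hQa : IsHPPP la Qa) (hQk : IsHPPP lk Qk) (hla : 0 < la) (hlk : 0 < lk)
    (hβ : 2 < β) {Λ : ℝ} (hΛ : Λ = la * interfConst β) {t : ℝ} (ht : 0 < t) :
    hopLaw₂ 1 Qk Qa Qe {d | ENNReal.ofReal t < sinrSK β 0 d} =
      ENNReal.ofReal (Real.pi * lk / Λ / (t ^ (2 / β) + Real.pi * lk / Λ)) := by
  have hc := interfConst_pos hβ
  have hΛ0 : 0 < Λ := by rw [hΛ]; positivity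
  have h := hQk.measure_lt_sir_nearest hlk (α := β) (Λ := Λ)
    (ρ := (markedLaw Qa ((rayleighVec 1).prod (rayleighVec 1))).prod
      (markedLaw Qe ((rayleighVec 1).prod (markedLaw Qa ((rayleighVec 1).prod (rayleighVec 1))))))
    (I := fun y q => apInterf β y q.1)
    (fun y => hΛ ▸ (hasInterfLaw_apInterf hQa hla hβ y).fst (by fun_prop))
    (by unfold Function.uncurry; fun_prop)
    (by linarith) hΛ0 (by fun_prop) isUnitExp_gain_rayleighVec ht
  rw [← ofReal_div_normalize hΛ0, ← h]
  simp_rw [sinrSK_eq]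
  rfl

theorem measure_sinrAPE_le (hQa : IsHPPP la Qa) (hQe : IsHPPP le Qe) (hla : 0 < la) (hle : 0 < le)
    (hβ : 2 < β) {Λ : ℝ} (hΛ : Λ = la * interfConst β) {y : ℝ} (hy : 0 < y) :
    hopLaw₂ 1 Qk Qa Qe {d | sinrAPE β 0 d ≤ ENNReal.ofReal y} =
      ENNReal.ofReal (Real.exp (-(Real.pi * le / Λ / y ^ (2 / β)))) := by
  have hc := interfConst_pos hβ
  have hΛ0 : 0 < Λ := by rw [hΛ]; positivity
  have hyβ := Real.rpow_pos_of_pos hy (2 / β)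
  let T : Set (Marked (EveMark₂ 1)) := {F | ⨆ k, eveSIR₂ β (F.1 k) (F.2 k) ≤ ENNReal.ofReal y}
  have hT : MeasurableSet T := measurableSet_le measurable_iSup_eveSIR₂ measurable_const
  have hmp : MeasurePreserving (fun d : Hop₂ 1 => d.2.2.2) (hopLaw₂ 1 Qk Qa Qe)
      (markedLaw Qe ((rayleighVec 1).prod (markedLaw Qa ((rayleighVec 1).prod (rayleighVec 1))))) :=
    measurePreserving_snd.comp (measurePreserving_snd.comp measurePreserving_snd)
  have h1 := hmp.measure_preimage hT.nullMeasurableSet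
  have h0 : hopLaw₂ 1 Qk Qa Qe {d | sinrAPE β 0 d ≤ ENNReal.ofReal y} =
      hopLaw₂ 1 Qk Qa Qe ((fun d : Hop₂ 1 => d.2.2.2) ⁻¹' T) := by
    refine measure_congr ?_
    filter_upwards [ae_hopLaw₂_ne_zero] with d hd
    refine propext ?_
    change sinrAPE β 0 d ≤ _ ↔ (⨆ k, eveSIR₂ β (d.2.2.2.1 k) (d.2.2.2.2 k)) ≤ _
    rw [sinrAPE_eq hd]
  rw [h0, h1, div_div]
  refine hQe.measure_iSup_le hle measurable_eveSIR₂ (c := Λ * y ^ (2 / β)) (by positivity)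
    fun x hx => ?_
  exact (hΛ ▸ hasInterfLaw_apInterf hQa hla hβ x : HasInterfLaw β Λ _ _).measure_lt_sir
    (by fun_prop) (by linarith) (by fun_prop) isUnitExp_gain_rayleighVec hx hy

/-- Both ratios involve the channel `g` of the typical access point. With one antenna the
eavesdroppers see only its phase, which has gain one, so their ratio is almost surely a function of
the eavesdropper coordinate alone. -/
lemma indepFun_sinrSK_sinrAPE :
    IndepFun (sinrSK β 0) (sinrAPE β 0) (hopLaw₂ 1 Qk Qa Qe) := by
  have h3 := indepFun_prod (μ := markedLaw Qa ((rayleighVec 1).prod (rayleighVec 1)))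
    (ν := markedLaw Qe ((rayleighVec 1).prod (markedLaw Qa ((rayleighVec 1).prod (rayleighVec 1)))))
    measurable_id measurable_id
  have h2 := indepFun_prod_snd (rayleighVec 1) (by fun_prop) (by fun_prop) h3
  have h1 := indepFun_prod_snd Qk (by fun_prop) (by fun_prop) h2
  let f : (ℕ → Plane) × (Fin 1 → ℂ) × Marked ((Fin 1 → ℂ) × (Fin 1 → ℂ)) → ℝ≥0∞ := fun p =>
    gain (p.2.1 0) * pathLoss β 0 (nearest p.1) / apInterf β (nearest p.1) p.2.2
  have hf : Measurable f := by unfold f; fun_prop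
  refine (h1.comp hf (measurable_iSup_eveSIR₂ (β := β))).congr (ae_of_all _ fun d => (sinrSK_eq d).symm) ?_
  filter_upwards [ae_hopLaw₂_ne_zero] with d hd using (sinrAPE_eq hd).symm

end

/-! ### Average secrecy rate -/

/-- Exponential decay of the tail of one variable suffices: the other probability is bounded by one,
as are both on `(0, 1]`. The layer-cake formula then passes from `[0, ∞]` to real integrals. -/
lemma integral_min_of_indepFun {Ω : Type*} [MeasurableSpace Ω] {P : Measure Ω}
    [IsProbabilityMeasure P] {U V : Ω → ℝ}
    (hU : AEMeasurable U P) (hV : AEMeasurable V P) (hU0 : ∀ ω, 0 ≤ U ω) (hV0 : ∀ ω, 0 ≤ V ω)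
    (hUV : IndepFun U V P) {C k : ℝ} (hk : 0 < k)
    (hUC : ∀ x : ℝ, 1 < x → P {ω | x < U ω} ≤ ENNReal.ofReal (C * Real.exp (-(k * x))))
    {p q : ℝ → ℝ} (hp : ∀ x : ℝ, 0 < x → (P {ω | x < U ω}).toReal = p x)
    (hq : ∀ x : ℝ, 0 < x → (P {ω | x < V ω}).toReal = q x) :
    Integrable (fun ω => min (U ω) (V ω)) P ∧
      ∫ ω, min (U ω) (V ω) ∂P = ∫ x in Ioi (0 : ℝ), p x * q x := by
  have hL := lintegral_ofReal_min hU hV hU0 hV0 hUV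
  have hmin : ∀ ω, 0 ≤ min (U ω) (V ω) := fun ω => le_min (hU0 ω) (hV0 ω)
  have hanti : ∀ W : Ω → ℝ, Antitone fun x : ℝ => P {ω | x < W ω} := fun W x y hxy =>
    measure_mono fun ω (h : y < W ω) => hxy.trans_lt h
  have hfin : ∫⁻ x in Ioi (0 : ℝ), P {ω | x < U ω} * P {ω | x < V ω} < ∞ := by
    have h1 : ∫⁻ x in Ioc (0 : ℝ) 1, P {ω | x < U ω} * P {ω | x < V ω} < ∞ := by
      refine (lintegral_mono (g := fun _ => 1) fun x => ?_).trans_lt (by simp)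
      exact mul_le_one' prob_le_one prob_le_one
    have h2 : ∫⁻ x in Ioi (1 : ℝ), P {ω | x < U ω} * P {ω | x < V ω} < ∞ := by
      -- No sign of `C` is assumed; `|C|` lets `ENNReal.ofReal` split the product.
      have h3 : ∫⁻ x in Ioi (1 : ℝ), P {ω | x < U ω} * P {ω | x < V ω} ≤
          ∫⁻ x in Ioi (1 : ℝ), ENNReal.ofReal |C| * ENNReal.ofReal (Real.exp (-(k * x))) := by
        refine setLIntegral_mono (by fun_prop) fun x hx => ?_
        rw [← ENNReal.ofReal_mul (abs_nonneg C)]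
        refine (mul_le_of_le_one_right' prob_le_one).trans ((hUC x hx).trans ?_)
        exact ENNReal.ofReal_le_ofReal (by gcongr; exact le_abs_self C)
      refine h3.trans_lt ?_
      rw [lintegral_const_mul _ (by fun_prop), lintegral_exp_mul_Ioi hk]
      exact ENNReal.mul_lt_top ENNReal.ofReal_lt_top ENNReal.ofReal_lt_top
    rw [← Ioc_union_Ioi_eq_Ioi zero_le_one]
    exact (lintegral_union_le _ _ _).trans_lt (ENNReal.add_lt_top.2 ⟨h1, h2⟩)
  have hm : AEStronglyMeasurable (fun ω => min (U ω) (V ω)) P := (hU.min hV).aestronglyMeasurable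
  refine ⟨⟨hm, (hasFiniteIntegral_iff_ofReal (ae_of_all _ hmin)).2 (hL ▸ hfin)⟩, ?_⟩
  rw [integral_eq_lintegral_of_nonneg_ae (ae_of_all _ hmin) hm, hL,
    ← setIntegral_congr_fun (f := fun x => (P {ω | x < U ω} * P {ω | x < V ω}).toReal)
      measurableSet_Ioi fun x hx => by
        simp only [ENNReal.toReal_mul, hp x hx, hq x hx],
    integral_toReal]
  · exact ((hanti U).measurable.mul (hanti V).measurable).aemeasurable
  · exact ae_of_all _ fun x => ENNReal.mul_lt_top (measure_lt_top _ _) (measure_lt_top _ _)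

lemma measurableSet_lt_secrecyAP {M : ℕ} {α μ N : ℝ} (x : ℝ) :
    MeasurableSet {d : Hop₁ M | x < secrecyAP α μ N d} :=
  measurableSet_lt measurable_const measurable_secrecyAP

lemma measurableSet_lt_secrecySK {M : ℕ} {β N : ℝ} (x : ℝ) :
    MeasurableSet {d : Hop₂ M | x < secrecySK β N d} :=
  measurableSet_lt measurable_const measurable_secrecySK

end WSN

/-! ### Assembly of the two hops -/

theorem corollary3
    (lams ρs lamap ρap lamsk lames lameap Ps Pap δsq α β : ℝ)
    (hlams : 0 < lams) (hρs : 0 < ρs ∧ ρs < 1)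
    (hlamap : 0 < lamap) (hρap : 0 < ρap ∧ ρap < 1)
    (hlamsk : 0 < lamsk) (hlames : 0 < lames) (hlameap : 0 < lameap)
    (hPs : 0 < Ps) (hPap : 0 < Pap) (hδsq : 0 ≤ δsq) (hα : 2 < α) (hβ : 2 < β)
    (M : ℕ) (hM : 1 ≤ M)
    (Qs Qr Qa Qk Qse Qape : MeasureTheory.Measure (ℕ → WSN.Plane))
    [MeasureTheory.IsProbabilityMeasure Qs] [MeasureTheory.IsProbabilityMeasure Qr]
    [MeasureTheory.IsProbabilityMeasure Qa] [MeasureTheory.IsProbabilityMeasure Qk]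
    [MeasureTheory.IsProbabilityMeasure Qse] [MeasureTheory.IsProbabilityMeasure Qape]
    (hQs : WSN.IsHPPP (lams * ρs) Qs)
    (hQr : WSN.IsHPPP (lamap * (1 - ρap)) Qr)
    (hQa : WSN.IsHPPP (lamap * ρap) Qa)
    (hQk : WSN.IsHPPP lamsk Qk)
    (hQse : WSN.IsHPPP lames Qse)
    (hQape : WSN.IsHPPP lameap Qape)
    {Ω : Type*} [MeasurableSpace Ω] (P : MeasureTheory.Measure Ω)
    [MeasureTheory.IsProbabilityMeasure P]
    (D₁ : Ω → WSN.Hop₁ M) (D₂ : Ω → WSN.Hop₂ M)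
    (hD₁ : ProbabilityTheory.HasLaw D₁ (WSN.hopLaw₁ M Qr Qs Qa Qse) P)
    (hD₂ : ProbabilityTheory.HasLaw D₂ (WSN.hopLaw₂ M Qk Qa Qape) P)
    (hind : ProbabilityTheory.IndepFun D₁ D₂ P) :
    -- the general form: any number of antennas, with or without noise
    (∫⁻ ω, ENNReal.ofReal (WSN.secrecy α β Ps Pap δsq (D₁ ω) (D₂ ω)) ∂P =
      ∫⁻ x in Set.Ioi (0 : ℝ),
        P {ω | x < WSN.secrecyAP α (Pap / Ps) (δsq / Ps) (D₁ ω)} *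
          P {ω | x < WSN.secrecySK β (δsq / Pap) (D₂ ω)}) ∧
    -- single antenna, interference-limited
    (M = 1 → δsq = 0 →
      MeasureTheory.Integrable (fun ω => WSN.secrecy α β Ps Pap δsq (D₁ ω) (D₂ ω)) P ∧
      ∫ ω, WSN.secrecy α β Ps Pap δsq (D₁ ω) (D₂ ω) ∂P =
        ∫ x in Set.Ioi (0 : ℝ),
          (∫ y in Set.Ioi (0 : ℝ),
            2 * Real.pi * lames / (α * WSN.Lam₁ lams ρs lamap ρap (Pap / Ps) α * y ^ (2 / α + 1)) *
              Real.exp (-(Real.pi * lames /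
                (WSN.Lam₁ lams ρs lamap ρap (Pap / Ps) α * y ^ (2 / α)))) *
              (Real.pi * lamap * (1 - ρap) /
                (WSN.Lam₁ lams ρs lamap ρap (Pap / Ps) α * (2 ^ x * (1 + y) - 1) ^ (2 / α) +
                  Real.pi * lamap * (1 - ρap)))) *
          (∫ y in Set.Ioi (0 : ℝ),
            2 * Real.pi ^ 2 * lameap * lamsk *
                Real.exp (-(Real.pi * lameap / (WSN.Lam₂ lamap ρap β * y ^ (2 / β)))) /
              (β * WSN.Lam₂ lamap ρap β * y ^ (2 / β + 1) *
                (WSN.Lam₂ lamap ρap β * (2 ^ x * (1 + y) - 1) ^ (2 / β) + Real.pi * lamsk)))) := by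
  have hU : AEMeasurable (fun ω => WSN.secrecyAP α (Pap / Ps) (δsq / Ps) (D₁ ω)) P :=
    WSN.measurable_secrecyAP.comp_aemeasurable hD₁.aemeasurable
  have hV : AEMeasurable (fun ω => WSN.secrecySK β (δsq / Pap) (D₂ ω)) P :=
    WSN.measurable_secrecySK.comp_aemeasurable hD₂.aemeasurable
  have hUV : IndepFun (fun ω => WSN.secrecyAP α (Pap / Ps) (δsq / Ps) (D₁ ω))
      (fun ω => WSN.secrecySK β (δsq / Pap) (D₂ ω)) P :=
    hind.comp WSN.measurable_secrecyAP WSN.measurable_secrecySK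
  have hU0 : ∀ ω, 0 ≤ WSN.secrecyAP α (Pap / Ps) (δsq / Ps) (D₁ ω) := fun ω => le_max_right _ _
  have hV0 : ∀ ω, 0 ≤ WSN.secrecySK β (δsq / Pap) (D₂ ω) := fun ω => le_max_right _ _
  refine ⟨WSN.lintegral_ofReal_min hU hV hU0 hV0 hUV, ?_⟩
  intro hM1 hδ
  subst hM1 hδ
  have hμ : 0 < Pap / Ps := div_pos hPap hPs
  have hls : 0 < lams * ρs := mul_pos hlams hρs.1
  have hla : 0 < lamap * ρap := mul_pos hlamap hρap.1
  have hlr : 0 < lamap * (1 - ρap) := mul_pos hlamap (by linarith [hρap.2])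
  have hα0 : 0 < 2 / α := div_pos two_pos (by linarith)
  have hβ0 : 0 < 2 / β := div_pos two_pos (by linarith)
  have hΛ₁ := WSN.Lam₁_eq lams ρs lamap ρap (Pap / Ps) α
  have hΛ₂ := WSN.Lam₂_eq lamap ρap β
  set Λ₁ := WSN.Lam₁ lams ρs lamap ρap (Pap / Ps) α
  set Λ₂ := WSN.Lam₂ lamap ρap β
  have hcα := WSN.interfConst_pos hα
  have hcβ := WSN.interfConst_pos hβ
  have hΛ₁0 : 0 < Λ₁ := by
    have := Real.rpow_pos_of_pos hμ (2 / α)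
    rw [hΛ₁]
    positivity
  have hΛ₂0 : 0 < Λ₂ := by rw [hΛ₂]; positivity
  have : IsProbabilityMeasure (WSN.hopLaw₁ 1 Qr Qs Qa Qse) := by unfold WSN.hopLaw₁; infer_instance
  have : IsProbabilityMeasure (WSN.hopLaw₂ 1 Qk Qa Qape) := by unfold WSN.hopLaw₂; infer_instance
  have hX₁ := fun t ht => WSN.measure_lt_sinrAP (Qe := Qse) hQs hQa hQr hls hla hlr hα hμ hΛ₁ (t := t) ht
  have hY₁ := fun y hy => WSN.measure_sinrSE_le (Qr := Qr) hQs hQa hQse hls hla hlames hα hμ hΛ₁ (y := y) hy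
  have hX₂ := fun t ht => WSN.measure_lt_sinrSK (Qe := Qape) hQa hQk hla hlamsk hβ hΛ₂ (t := t) ht
  have hY₂ := fun y hy => WSN.measure_sinrAPE_le (Qk := Qk) hQa hQape hla hlameap hβ hΛ₂ (y := y) hy
  simp only [zero_div] at hU hV hUV hU0 hV0
  unfold WSN.secrecy
  simp only [zero_div]
  -- `k` and `C` are the constants of `measure_lt_secrecyRate_le` for the first hop, with `κ = 2 /
  -- α` and `a = π lamap (1 - ρap) / Λ₁`.
  refine WSN.integral_min_of_indepFun hU hV hU0 hV0 hUV
    (k := 2 / α * Real.log 2) (C := Real.pi * (lamap * (1 - ρap)) / Λ₁ * 2 ^ (2 / α))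
    (mul_pos hα0 (Real.log_pos one_lt_two)) (fun x hx => ?_) (fun x hx => ?_) (fun x hx => ?_)
  · rw [hD₁.measure_eq (WSN.measurableSet_lt_secrecyAP x)]
    exact WSN.measure_lt_secrecyRate_le (by positivity) hα0 hX₁ hx
  · rw [hD₁.measure_eq (WSN.measurableSet_lt_secrecyAP x)]
    refine (WSN.measure_lt_secrecyRate WSN.measurable_sinrAP WSN.measurable_sinrSE
      WSN.indepFun_sinrAP_sinrSE (by positivity) (by positivity) hα0 hX₁ hY₁ hx).trans ?_
    refine setIntegral_congr_fun measurableSet_Ioi fun y hy => ?_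
    have hz : 0 < 2 ^ x * (1 + y) - 1 := by linarith [WSN.one_lt_two_rpow_mul hx (le_of_lt hy)]
    have h1 := Real.rpow_pos_of_pos hz (2 / α)
    have h2 : 0 < y ^ (2 / α) := Real.rpow_pos_of_pos hy _
    have h3 : 0 < y ^ (2 / α + 1) := Real.rpow_pos_of_pos hy _
    simp only [WSN.evePDF]
    rw [div_div (Real.pi * lames)]
    field_simp
  · rw [hD₂.measure_eq (WSN.measurableSet_lt_secrecySK x)]
    refine (WSN.measure_lt_secrecyRate WSN.measurable_sinrSK WSN.measurable_sinrAPE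
      WSN.indepFun_sinrSK_sinrAPE (by positivity) (by positivity) hβ0 hX₂ hY₂ hx).trans ?_
    refine setIntegral_congr_fun measurableSet_Ioi fun y hy => ?_
    have hz : 0 < 2 ^ x * (1 + y) - 1 := by linarith [WSN.one_lt_two_rpow_mul hx (le_of_lt hy)]
    have h1 := Real.rpow_pos_of_pos hz (2 / β)
    have h2 : 0 < y ^ (2 / β) := Real.rpow_pos_of_pos hy _
    have h3 : 0 < y ^ (2 / β + 1) := Real.rpow_pos_of_pos hy _
    simp only [WSN.evePDF]
    rw [div_div (Real.pi * lameap)]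
    field_simp
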